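/- Let $j\ge 0$ be an integer, $N=2j+1$, and let $q,a,c,\alpha$ be real with $0<q<1$, $0<\alpha<1$, $c\ne a$, $q<a/c<q^{-1}$, and $ac<1$ or $ac>q^{1-N}$. Write $(z;q)_n=\prod_{k=0}^{n-1}(1-zq^k)$ and $(z_1,\dots,z_r;q)_n=\prod_i (z_i;q)_n$. The monic $q$-para-Racah polynomials are defined by $R_{-1}=0$, $R_0=1$, $xR_n(x)=R_{n+1}(x)+b_nR_n(x)+u_nR_{n-1}(x)$ for $0\le n\le N$, where $$b_n=\frac{(a+c)(q^{j+1}+1)q^n(acq^j+1)}{2ac(q^j+q^n)(q^{j+1}+q^n)}\quad(n\ne j,j+1),$$ $$b_n=\frac{a+a^{-1}}2+\frac{\alpha_n(c-a)(q^{j+1}-1)q^{-j}(acq^j-1)}{2ac(q-1)}-\frac{(q^j-1)q^{-j}(c-aq)(acq^{j+1}-1)}{2ac(q^2-1)}\quad(n=j,j+1)$$ with $\alpha_j=\alpha$, $\alpha_{j+1}=1-\alpha$, and $$u_n=\frac{(q^n-1)(q^n-q^{2j+2})(acq^n-q)(q^n-acq^{2j+1})(aq^n-cq^{j+1})(cq^n-aq^{j+1})}{4a^2c^2(q^{j+1}+q^n)^2(q^{2n}-q^{2j+1})(q^{2n}-q^{2j+3})}\quad(n\ne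 j+1),$$ $$u_{j+1}=\frac{(1-\alpha)\alpha(c-a)^2q^{-2j}(q^{j+1}-1)^2(acq^j-1)^2}{4a^2c^2(q-1)^2}.$$ Let $x_{2s}=\tfrac12(a^{-1}q^{-s}+aq^s)$ and $x_{2s+1}=\tfrac12(c^{-1}q^{-s}+cq^s)$ for $0\le s\le j$, and let $$K_N=\frac{(a-c)q^{-j}(q^{j+1}-1)(acq^j-1)\,(q^{-j};q)_j^2\,(q^{-2j-1},q,ac,\tfrac{aq^{-j}}{c},\tfrac{cq^{-j}}{a},\tfrac{q^{-2j}}{ac};q)_j}{ac(q-1)2^{2j+2}\,(q^{-2j-1};q^2)_j\,(q^{-2j};q^2)_j^2\,(q^{1-2j};q^2)_j}.$$ Then: 1. $u_n>0$ for $1\le n\le N$; the points $x_0,\dots,x_N$ are distinct and $R_{N+1}(x)=\prod_{s=0}^N(x-x_s)$. 2. The numbers $w_s=\dfrac{u_1u_2\cdots u_N}{R_N(x_s)R_{N+1}'(x_s)}$, $0\le s\le N$, are well defined (the denominators do not vanish) and positive, and for $0\le n,m\le N$ $$\sum_{s=0}^N w_sR_n(x_s)R_m(x_s)=u_1u_2\cdots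 u_n\,\delta_{nm}.$$ 3. For $\alpha=\tfrac12$, $R_N(x_s)=(-1)^sK_N$ for $0\le s\le N$. For general $\alpha$, $w_s=(1+(1-2\alpha)(-1)^s)\,\tilde w_s$, where $\tilde w_s$ is the weight for $\alpha=\tfrac12$ (same $q,a,c$). 4. For $0\le s\le j$, $$w_{2s}=-\frac{2(1-\alpha)K_N2^{2j+1}a^jc^{j+1}q^{(2j+1)s+(j+1)j}(1-a^2q^{2s})(a^2,q^{-j},ac,\tfrac{aq^{-j}}{c};q)_s}{(q,a^2q;q)_j(\tfrac ca,ac;q)_{j+1}(1-a^2)(q,\tfrac{aq}{c},a^2q^{j+1},acq^{j+1};q)_s},$$ $$w_{2s+1}=\frac{2\alpha K_N2^{2j+1}c^ja^{j+1}q^{(2j+1)s+(j+1)j}(1-c^2q^{2s})(c^2,q^{-j},ac,\tfrac{cq^{-j}}{a};q)_s}{(q,c^2q;q)_j(\tfrac ac,ac;q)_{j+1}(1-c^2)(q,\tfrac{cq}{a},c^2q^{j+1},acq^{j+1};q)_s},$$ the first formula being taken literally if $a^2\notin\{1,q^{-2j}\}$ and the second if $c^2\notin\{1,q^{-2j}\}$.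 In all cases they hold with the common factors cancelled, that is, with $\frac{(1-z q^{2s})(z;q)_s}{(1-z)(zq;q)_j(zq^{j+1};q)_s}$ (for $z=a^2$, resp. $z=c^2$) replaced by $\prod_{s\le k\le s+j,\ k\ne 2s}(1-zq^k)^{-1}$, where the product does not vanish. 5. Let $\tilde u_n$ be the coefficients $u_n$ for $\alpha=\tfrac12$. Then $K_N=\operatorname{sgn}\big((c-a)(1-ac)\big)\sqrt{\tilde u_1\tilde u_2\cdots\tilde u_N}$. 6. $\displaystyle\sum_{s=0}^jw_{2s}=1-\alpha$ and $\displaystyle\sum_{s=0}^jw_{2s+1}=\alpha$. -/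

import Mathlib

open Polynomial

namespace QParaRacah

/-- The `q`-Pochhammer symbol `(z;q)_n = (1 - z)(1 - z q) ⋯ (1 - z q^(n-1))`. -/
noncomputable def qPoch (z q : ℝ) (n : ℕ) : ℝ :=
  ∏ k ∈ Finset.range n, (1 - z * q ^ k)

/-- The diagonal recurrence coefficients `b_n` of the monic `q`-para-Racah polynomials with
`N = 2 j + 1`. -/
noncomputable def bCoeff (q a c α : ℝ) (j n : ℕ) : ℝ :=
  if n = j then
    (a + a⁻¹) / 2
      + α * (c - a) * (q ^ (j + 1) - 1) * q ^ (-(j : ℤ)) * (a * c * q ^ j - 1)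
          / (2 * a * c * (q - 1))
      - (q ^ j - 1) * q ^ (-(j : ℤ)) * (c - a * q) * (a * c * q ^ (j + 1) - 1)
          / (2 * a * c * (q ^ 2 - 1))
  else if n = j + 1 then
    (a + a⁻¹) / 2
      + (1 - α) * (c - a) * (q ^ (j + 1) - 1) * q ^ (-(j : ℤ)) * (a * c * q ^ j - 1)
          / (2 * a * c * (q - 1))
      - (q ^ j - 1) * q ^ (-(j : ℤ)) * (c - a * q) * (a * c * q ^ (j + 1) - 1)
          / (2 * a * c * (q ^ 2 - 1))
  else
    (a + c) * (q ^ (j + 1) + 1) * q ^ n * (a * c * q ^ j + 1)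
      / (2 * a * c * (q ^ j + q ^ n) * (q ^ (j + 1) + q ^ n))

/-- The off-diagonal recurrence coefficients `u_n` (used for `1 ≤ n ≤ N = 2 j + 1`). -/
noncomputable def uCoeff (q a c α : ℝ) (j n : ℕ) : ℝ :=
  if n = j + 1 then
    (1 - α) * α * (c - a) ^ 2 * q ^ (-(2 * (j : ℤ))) * (q ^ (j + 1) - 1) ^ 2
        * (a * c * q ^ j - 1) ^ 2
      / (4 * a ^ 2 * c ^ 2 * (q - 1) ^ 2)
  else
    (q ^ n - 1) * (q ^ n - q ^ (2 * j + 2)) * (a * c * q ^ n - q)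
        * (q ^ n - a * c * q ^ (2 * j + 1)) * (a * q ^ n - c * q ^ (j + 1))
        * (c * q ^ n - a * q ^ (j + 1))
      / (4 * a ^ 2 * c ^ 2 * (q ^ (j + 1) + q ^ n) ^ 2 * (q ^ (2 * n) - q ^ (2 * j + 1))
        * (q ^ (2 * n) - q ^ (2 * j + 3)))

/-- The product `u_1 u_2 ⋯ u_n`. -/
noncomputable def uProd (q a c α : ℝ) (j n : ℕ) : ℝ :=
  ∏ k ∈ Finset.Icc 1 n, uCoeff q a c α j k

/-- The monic `q`-para-Racah polynomials for `N = 2 j + 1`, given by the three-term recurrence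
`x R_n = R_{n+1} + b_n R_n + u_n R_{n-1}` with `R_{-1} = 0` and `R_0 = 1`. The polynomial
`R (2 j + 2)` is the characteristic polynomial `R_{N+1}`. -/
noncomputable def R (q a c α : ℝ) (j : ℕ) : ℕ → ℝ[X]
  | 0 => 1
  | 1 => X - C (bCoeff q a c α j 0)
  | n + 2 => (X - C (bCoeff q a c α j (n + 1))) * R q a c α j (n + 1)
      - C (uCoeff q a c α j (n + 1)) * R q a c α j n

/-- The biexponential bi-lattice: `x_{2s} = (a⁻¹ q^(-s) + a q^s) / 2` and
`x_{2s+1} = (c⁻¹ q^(-s) + c q^s) / 2`. -/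
noncomputable def lattice (q a c : ℝ) (i : ℕ) : ℝ :=
  if i % 2 = 0 then
    (a⁻¹ * q ^ (-((i / 2 : ℕ) : ℤ)) + a * q ^ (i / 2)) / 2
  else
    (c⁻¹ * q ^ (-((i / 2 : ℕ) : ℤ)) + c * q ^ (i / 2)) / 2

/-- The weights `w_i = u_1 ⋯ u_N / (R_N(x_i) R'_{N+1}(x_i))` with `N = 2 j + 1`. -/
noncomputable def weight (q a c α : ℝ) (j i : ℕ) : ℝ :=
  uProd q a c α j (2 * j + 1)
    / ((R q a c α j (2 * j + 1)).eval (lattice q a c i)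
      * (derivative (R q a c α j (2 * j + 2))).eval (lattice q a c i))

/-- The normalization constant `K_N` in closed form, `N = 2 j + 1`. -/
noncomputable def KN (q a c : ℝ) (j : ℕ) : ℝ :=
  (a - c) * q ^ (-(j : ℤ)) * (q ^ (j + 1) - 1) * (a * c * q ^ j - 1)
      * qPoch (q ^ (-(j : ℤ))) q j ^ 2 * qPoch (q ^ (-2 * (j : ℤ) - 1)) q j * qPoch q q j
      * qPoch (a * c) q j * qPoch (a * q ^ (-(j : ℤ)) / c) q j
      * qPoch (c * q ^ (-(j : ℤ)) / a) q j * qPoch (q ^ (-2 * (j : ℤ)) / (a * c)) q j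
    / (a * c * (q - 1) * 2 ^ (2 * j + 2) * qPoch (q ^ (-2 * (j : ℤ) - 1)) (q ^ 2) j
      * qPoch (q ^ (-2 * (j : ℤ))) (q ^ 2) j ^ 2 * qPoch (q ^ (1 - 2 * (j : ℤ))) (q ^ 2) j)

/-- The closed form of the weight `w_{2s}`. -/
noncomputable def evenWeight (q a c α : ℝ) (j s : ℕ) : ℝ :=
  -(2 * (1 - α) * KN q a c j * 2 ^ (2 * j + 1) * a ^ j * c ^ (j + 1)
      * q ^ ((2 * j + 1) * s + (j + 1) * j) * (1 - a ^ 2 * q ^ (2 * s)) * qPoch (a ^ 2) q s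
      * qPoch (q ^ (-(j : ℤ))) q s * qPoch (a * c) q s * qPoch (a * q ^ (-(j : ℤ)) / c) q s)
    / (qPoch q q j * qPoch (a ^ 2 * q) q j * qPoch (c / a) q (j + 1) * qPoch (a * c) q (j + 1)
      * (1 - a ^ 2) * qPoch q q s * qPoch (a * q / c) q s * qPoch (a ^ 2 * q ^ (j + 1)) q s
      * qPoch (a * c * q ^ (j + 1)) q s)

/-- The closed form of the weight `w_{2s+1}`. -/
noncomputable def oddWeight (q a c α : ℝ) (j s : ℕ) : ℝ :=
  (2 * α * KN q a c j * 2 ^ (2 * j + 1) * c ^ j * a ^ (j + 1)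
      * q ^ ((2 * j + 1) * s + (j + 1) * j) * (1 - c ^ 2 * q ^ (2 * s)) * qPoch (c ^ 2) q s
      * qPoch (q ^ (-(j : ℤ))) q s * qPoch (a * c) q s * qPoch (c * q ^ (-(j : ℤ)) / a) q s)
    / (qPoch q q j * qPoch (c ^ 2 * q) q j * qPoch (a / c) q (j + 1) * qPoch (a * c) q (j + 1)
      * (1 - c ^ 2) * qPoch q q s * qPoch (c * q / a) q s * qPoch (c ^ 2 * q ^ (j + 1)) q s
      * qPoch (a * c * q ^ (j + 1)) q s)

/-- The product of `1 - z q^k` over `s ≤ k ≤ s + j`, `k ≠ 2 s`. As rational functions of `z`,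
`(1 - z q^(2s)) (z;q)_s / ((1 - z) (zq;q)_j (z q^(j+1);q)_s)` is the reciprocal of this product
for `s ≤ j`. -/
noncomputable def reducedDenom (z q : ℝ) (j s : ℕ) : ℝ :=
  ∏ k ∈ (Finset.Icc s (s + j)).erase (2 * s), (1 - z * q ^ k)

/-- `evenWeight` with the factors common to numerator and denominator cancelled, so that it is
also meaningful where `(1 - a^2) (1 - a^2 q^(2j)) = 0`. -/
noncomputable def evenWeightReduced (q a c α : ℝ) (j s : ℕ) : ℝ :=
  -(2 * (1 - α) * KN q a c j * 2 ^ (2 * j + 1) * a ^ j * c ^ (j + 1)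
      * q ^ ((2 * j + 1) * s + (j + 1) * j)
      * qPoch (q ^ (-(j : ℤ))) q s * qPoch (a * c) q s * qPoch (a * q ^ (-(j : ℤ)) / c) q s)
    / (qPoch q q j * qPoch (c / a) q (j + 1) * qPoch (a * c) q (j + 1)
      * reducedDenom (a ^ 2) q j s * qPoch q q s * qPoch (a * q / c) q s
      * qPoch (a * c * q ^ (j + 1)) q s)

/-- `oddWeight` with the factors common to numerator and denominator cancelled, so that it is
also meaningful where `(1 - c^2) (1 - c^2 q^(2j)) = 0`. -/
noncomputable def oddWeightReduced (q a c α : ℝ) (j s : ℕ) : ℝ :=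
  (2 * α * KN q a c j * 2 ^ (2 * j + 1) * c ^ j * a ^ (j + 1)
      * q ^ ((2 * j + 1) * s + (j + 1) * j)
      * qPoch (q ^ (-(j : ℤ))) q s * qPoch (a * c) q s * qPoch (c * q ^ (-(j : ℤ)) / a) q s)
    / (qPoch q q j * qPoch (a / c) q (j + 1) * qPoch (a * c) q (j + 1)
      * reducedDenom (c ^ 2) q j s * qPoch q q s * qPoch (c * q / a) q s
      * qPoch (a * c * q ^ (j + 1)) q s)

end QParaRacah

open QParaRacah

namespace QParaRacah

/-! Write `E` and `O` for the monic polynomials vanishing at the even and at the odd lattice points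
(`evenPoly q a c j` and `evenPoly q c a j`). Everything rests on the two middle polynomials: `R_j`
is a multiple of `E - O`, and `R_{j+1} = (1-α) E + α O`.

Up to degree `j`, `R_n` is a basic hypergeometric sum in the Newton basis at the even points
(`eval_R_eq_newtonSum`). Its coefficients satisfy a difference equation in `X = q^n` that reproduces
the recurrence. The sum must stop at index `j`, and multiplication by `x - x_0` then leaves one
boundary term, a multiple of `E`. This term vanishes for `n < j`; at `n = j` it is `R_{j+1}` for `α
= 0`, so that polynomial is `E` (`R_zero_succ`). Exchanging `a` with `c` and `α` with `1-α`
preserves the family, so `R_{j+1} = O` for `α = 1`. Below degree `j+2` the parameter enters only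
through `b_j`, affinely, which gives the two middle formulas (`bJump_mul_R`, `R_mid_succ_eq`).

The coefficients are also invariant under reversing the index together with `α ↦ 1-α`. Cutting the
Jacobi matrix in the middle thus expresses `R_{N+1}` by the middle polynomials, and the dependence
on `α` cancels: `((1-α)E + αO)(αE + (1-α)O) - α(1-α)(E-O)^2 = EO` (`R_last`). At a zero of `R_{N+1}`
the recurrence can also be run downwards from degree `N`. Comparison at the middle shows that `R_N`
takes only the values `2αK_N` on the even and `-2(1-α)K_N` on the odd points (`eval_R_even`,
`eval_R_odd`).

Positivity and orthogonality follow from positive `u_n` by Christoffel–Darboux. The closed form of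
the weights is the evaluation of `R_{N+1}'` as a product of lattice differences. -/

/-- The conditions on `q`, `a`, `c` under which the `q`-para-Racah polynomials are considered. -/
structure Admissible (j : ℕ) (q a c : ℝ) : Prop where
  q_pos : 0 < q
  q_lt_one : q < 1
  ne : c ≠ a
  lower : q < a / c
  upper : a / c < q⁻¹
  prod : a * c < 1 ∨ q ^ (1 - (2 * (j : ℤ) + 1)) < a * c

/-! ### Consequences of the parameter conditions -/

namespace Admissible

variable {j : ℕ} {q a c : ℝ}

theorem ratio_pos (h : Admissible j q a c) : 0 < a / c := h.q_pos.trans h.lower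

theorem ratio_mul_lt (h : Admissible j q a c) : a / c * q < 1 :=
  (lt_div_iff₀ h.q_pos).1 (by simpa only [one_div] using h.upper)

theorem a_ne (h : Admissible j q a c) : a ≠ 0 := by
  rintro rfl
  simpa using h.ratio_pos

theorem c_ne (h : Admissible j q a c) : c ≠ 0 := by
  rintro rfl
  simpa using h.ratio_pos

theorem q_ne (h : Admissible j q a c) : q ≠ 0 := h.q_pos.ne'

theorem mul_pos (h : Admissible j q a c) : 0 < a * c := by
  have h1 : a * c = a / c * c ^ 2 := by
    have := h.c_ne
    field_simp
  rw [h1]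
  have := h.c_ne
  have := h.ratio_pos
  positivity

theorem symm (h : Admissible j q a c) : Admissible j q c a where
  q_pos := h.q_pos
  q_lt_one := h.q_lt_one
  ne := h.ne.symm
  lower := by
    have := (lt_inv_comm₀ h.ratio_pos h.q_pos).1 h.upper
    rwa [inv_div] at this
  upper := by
    have := (inv_lt_inv₀ h.ratio_pos h.q_pos).2 h.lower
    rwa [inv_div] at this
  prod := by rw [mul_comm c a]; exact h.prod

theorem prod' (h : Admissible j q a c) : a * c < 1 ∨ 1 < a * c * q ^ (2 * j) := by
  refine h.prod.imp id fun h1 => ?_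
  have h2 : q ^ (1 - (2 * (j : ℤ) + 1)) = (q ^ (2 * j))⁻¹ := by
    rw [← zpow_natCast, ← zpow_neg]
    congr 1
    push_cast
    ring
  rw [h2] at h1
  have h3 : 0 < q ^ (2 * j) := pow_pos h.q_pos _
  rwa [inv_lt_iff_one_lt_mul₀ h3] at h1

theorem pow_le_one (h : Admissible j q a c) (n : ℕ) : q ^ n ≤ 1 :=
  pow_le_one₀ h.q_pos.le h.q_lt_one.le

theorem pow_lt_pow (h : Admissible j q a c) {m n : ℕ} (hmn : m < n) : q ^ n < q ^ m :=
  pow_lt_pow_right_of_lt_one₀ h.q_pos h.q_lt_one hmn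

theorem pow_le_pow (h : Admissible j q a c) {m n : ℕ} (hmn : m ≤ n) : q ^ n ≤ q ^ m :=
  pow_le_pow_of_le_one h.q_pos.le h.q_lt_one.le hmn

theorem pow_ne_pow (h : Admissible j q a c) {m n : ℕ} (hmn : m ≠ n) : q ^ m ≠ q ^ n :=
  fun e => hmn (pow_right_injective₀ h.q_pos h.q_lt_one.ne e)

theorem pow_ne_one (h : Admissible j q a c) {n : ℕ} (hn : n ≠ 0) : q ^ n ≠ 1 := by
  simpa using h.pow_ne_pow hn

/-- All `1 - a c q^i`, `i ≤ 2 j`, have the sign of `1 - a c`. -/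
theorem mul_sign (h : Admissible j q a c) :
    (∀ i, a * c * q ^ i < 1) ∨ (∀ i ≤ 2 * j, 1 < a * c * q ^ i) := by
  refine h.prod'.imp (fun h1 i => ?_) fun h1 i hi => ?_
  · nlinarith [h.pow_le_one i, h.mul_pos]
  · nlinarith [h.pow_le_pow hi, h.mul_pos]

theorem mul_pow_ne_one (h : Admissible j q a c) {i : ℕ} (hi : i ≤ 2 * j) :
    a * c * q ^ i ≠ 1 := by
  rcases h.mul_sign with h1 | h1
  · exact (h1 i).ne
  · exact (h1 i hi).ne'

/-- The ratio `a / c` lies strictly between `q` and `q⁻¹` and is not `1`, so it is no integer power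
of `q`. This separates the even points from the odd ones. -/
theorem mul_pow_ne_mul_pow (h : Admissible j q a c) (m n : ℕ) : a * q ^ m ≠ c * q ^ n := by
  intro e
  have hc := h.c_ne
  have hq := h.q_pos
  have e' : a / c * q ^ m = q ^ n := by
    field_simp
    exact e
  rcases lt_trichotomy m n with hmn | rfl | hmn
  · obtain ⟨d, rfl⟩ := Nat.exists_eq_add_of_lt hmn
    have h1 : a / c = q ^ (d + 1) := by
      have : q ^ m ≠ 0 := (pow_pos hq m).ne'
      apply mul_right_cancel₀ this
      rw [e']
      ring
    have h2 := h.lower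
    rw [h1] at h2
    have h3 := h.pow_le_pow (show 1 ≤ d + 1 by omega)
    rw [pow_one] at h3
    linarith
  · have : q ^ m ≠ 0 := (pow_pos hq m).ne'
    exact h.ne (mul_right_cancel₀ this e).symm
  · obtain ⟨d, rfl⟩ := Nat.exists_eq_add_of_lt hmn
    have h1 : a / c * q ^ (d + 1) = 1 := by
      have : q ^ n ≠ 0 := (pow_pos hq n).ne'
      apply mul_right_cancel₀ this
      rw [one_mul]
      refine Eq.trans ?_ e'
      ring
    have h2 := h.ratio_mul_lt
    have h3 := h.pow_le_pow (show 1 ≤ d + 1 by omega)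
    rw [pow_one] at h3
    nlinarith [h.ratio_pos]

/-- Write `a^2 = (a c)(a / c)` and move one power of `q` to whichever factor needs it. The exponents
`0` and `2 j` are left out because equality can occur there; distinct `s, t ≤ j` never have `s + t`
equal to either. -/
theorem sq_mul_pow_ne_one (h : Admissible j q a c) {i : ℕ} (hi : 1 ≤ i) (hi' : i + 1 ≤ 2 * j) :
    a ^ 2 * q ^ i ≠ 1 := by
  have h0 := h.mul_pos
  have hc := h.c_ne
  have hq := h.q_pos
  have e : a ^ 2 = a * c * (a / c) := by field_simp
  have hr := h.ratio_pos
  have hu : a / c * q < 1 := h.ratio_mul_lt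
  have hl := h.lower
  rw [e]
  obtain ⟨i, rfl⟩ := Nat.exists_eq_add_of_le' hi
  rcases h.mul_sign with h1 | h1
  · have h2 := h1 i
    have : a * c * (a / c) * q ^ (i + 1) = (a * c * q ^ i) * (a / c * q) := by ring
    rw [this]
    have h3 : 0 < a * c * q ^ i := by positivity
    exact (by nlinarith : _ < (1 : ℝ)).ne
  · have h2 := h1 (i + 1 + 1) hi'
    have h3 : a * c * (a / c) * q ^ (i + 1) * q = (a * c * q ^ (i + 1 + 1)) * (a / c) := by ring
    have h4 : q < a * c * (a / c) * q ^ (i + 1) * q := by rw [h3]; nlinarith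
    intro h5
    rw [h5] at h4
    linarith

end Admissible

/-! ### Newton expansion at the even points, degrees up to `j + 1` -/

theorem zpow_neg_eq (q : ℝ) (j : ℕ) : q ^ (-(j : ℤ)) = (q ^ j)⁻¹ := by
  rw [zpow_neg, zpow_natCast]

theorem lattice_even (q a c : ℝ) (s : ℕ) :
    lattice q a c (2 * s) = (a⁻¹ * (q ^ s)⁻¹ + a * q ^ s) / 2 := by
  simp [lattice]

theorem lattice_odd (q a c : ℝ) (s : ℕ) :
    lattice q a c (2 * s + 1) = (c⁻¹ * (q ^ s)⁻¹ + c * q ^ s) / 2 := by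
  have h1 : (2 * s + 1) % 2 = 1 := by omega
  have h2 : (2 * s + 1) / 2 = s := by omega
  simp [lattice, h1, h2]

theorem lattice_odd_eq_swap (q a c : ℝ) (s : ℕ) :
    lattice q a c (2 * s + 1) = lattice q c a (2 * s) := by
  rw [lattice_odd, lattice_even]

/-- The factor of the Newton coefficients that depends on the degree, through `X = q^n`. -/
noncomputable def newtonNum (q : ℝ) (j : ℕ) (X : ℝ) (k : ℕ) : ℝ :=
  ∏ i ∈ Finset.range k, ((X - q ^ i) * (q * (q ^ j) ^ 2 - X * q ^ i) / X)

/-- One factor of the denominator of the Newton coefficients. -/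
noncomputable def newtonDen (q a c : ℝ) (j i : ℕ) : ℝ :=
  -((1 - q ^ (i + 1)) * (q ^ j - q ^ i) * (1 - a * c * q ^ i) * (c * q ^ j - a * q ^ i))
    / (2 * a * c * q ^ i)

/-- The coefficients of the (non-monic) polynomials in the Newton basis at the even lattice
points. -/
noncomputable def newtonCoeff (q a c : ℝ) (j : ℕ) (X : ℝ) (k : ℕ) : ℝ :=
  newtonNum q j X k / ∏ i ∈ Finset.range k, newtonDen q a c j i

/-- The Newton basis at the even lattice points. -/
noncomputable def newtonBasis (q a c : ℝ) (k : ℕ) (x : ℝ) : ℝ :=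
  ∏ i ∈ Finset.range k, (x - lattice q a c (2 * i))

/-- The polynomial with coefficients `newtonCoeff`, as a function. -/
noncomputable def newtonSum (q a c : ℝ) (j : ℕ) (X x : ℝ) : ℝ :=
  ∑ k ∈ Finset.range (j + 1), newtonCoeff q a c j X k * newtonBasis q a c k x

/-- The coefficient `A_n` of the difference equation in the degree, as a function of `X = q^n`. -/
noncomputable def stepUp (q a c : ℝ) (j : ℕ) (X : ℝ) : ℝ :=
  (1 - a * c * X) * (c * q ^ j - a * X) * (q * (q ^ j) ^ 2 - X)
    / (2 * a * c * (q * (q ^ j) ^ 2 - X ^ 2) * (q ^ j + X))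

/-- The coefficient `C_n` of the difference equation in the degree, as a function of `X = q^n`. -/
noncomputable def stepDown (q a c : ℝ) (j : ℕ) (X : ℝ) : ℝ :=
  (1 - X) * (a * q * q ^ j - c * X) * (a * c * (q * (q ^ j) ^ 2) - X)
    / (2 * a * c * (q * q ^ j + X) * (q * (q ^ j) ^ 2 - X ^ 2))

/-- The common factor of `newtonNum` at `q X`, `X` and `X / q`. -/
noncomputable def newtonCommon (q : ℝ) (j : ℕ) (X : ℝ) (k : ℕ) : ℝ :=
  ∏ i ∈ Finset.range k, ((X - q ^ i) * (q * (q ^ j) ^ 2 - X * q ^ (i + 1)) / X)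

/-- Shifting the index in the factors `q^(2j+1) - X q^i` changes only the two end factors. With the
next three lemmas this brings the values at `q X`, `X` and `X / q` over one common product. -/
theorem newtonNum_mul (q : ℝ) (j : ℕ) (X : ℝ) (k : ℕ) :
    newtonNum q j X k * (q * (q ^ j) ^ 2 - X * q ^ k)
      = (q * (q ^ j) ^ 2 - X) * newtonCommon q j X k := by
  induction k with
  | zero => simp [newtonNum, newtonCommon]
  | succ k ih =>
    rw [newtonNum, Finset.prod_range_succ, ← newtonNum, newtonCommon, Finset.prod_range_succ,
      ← newtonCommon]
    linear_combination (X - q ^ k) * (q * (q ^ j) ^ 2 - X * q ^ (k + 1)) / X * ih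

theorem newtonNum_succ (q : ℝ) (j : ℕ) (X : ℝ) (k : ℕ) :
    newtonNum q j X (k + 1)
      = newtonCommon q j X k * ((X - q ^ k) * (q * (q ^ j) ^ 2 - X) / X) := by
  rw [newtonNum, Finset.prod_range_succ, ← newtonNum]
  linear_combination (X - q ^ k) / X * newtonNum_mul q j X k

theorem newtonNum_up (q : ℝ) (j : ℕ) {X : ℝ} (hq : q ≠ 0) (hX : X ≠ 0) (k : ℕ) :
    newtonNum q j (q * X) (k + 1)
      = newtonCommon q j X k
        * ((q * X - 1) * (q * (q ^ j) ^ 2 - X * q ^ (k + 1)) / (q * X)) := by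
  induction k with
  | zero => simp [newtonNum, newtonCommon]; ring
  | succ k ih =>
    rw [newtonNum, Finset.prod_range_succ, ← newtonNum, ih, newtonCommon, newtonCommon,
      Finset.prod_range_succ]
    field_simp
    ring

theorem newtonNum_down (q : ℝ) (j : ℕ) {X : ℝ} (hq : q ≠ 0) (hX : X ≠ 0) (k : ℕ) :
    newtonNum q j (X / q) (k + 1) * ((X - 1) * (q * (q ^ j) ^ 2 - X * q ^ k))
      = newtonCommon q j X k * ((q * (q ^ j) ^ 2 - X / q) * (q * (q ^ j) ^ 2 - X)
        * (X - q ^ k) * (X - q ^ (k + 1)) / X) := by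
  induction k with
  | zero => simp [newtonNum, newtonCommon]; field_simp
  | succ k ih =>
    rw [newtonNum, Finset.prod_range_succ, ← newtonNum, newtonCommon, Finset.prod_range_succ,
      ← newtonCommon]
    have e : (X / q - q ^ (k + 1)) * (q * (q ^ j) ^ 2 - X / q * q ^ (k + 1)) / (X / q)
        = (X - q ^ (k + 2)) * (q * (q ^ j) ^ 2 - X * q ^ k) / X := by
      field_simp
      ring
    rw [e]
    linear_combination (X - q ^ (k + 2)) * (q * (q ^ j) ^ 2 - X * q ^ (k + 1)) / X * ih

/-- The coefficientwise form of the difference equation in the degree. Once the common product is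
removed, it is a rational identity in `X`, `q^k`, `q^j`, `q`, `a`, `c`. -/
theorem newtonNum_difference_eq {q a c : ℝ} {j : ℕ} {X : ℝ} {k : ℕ} (hq : q ≠ 0) (ha : a ≠ 0)
    (hc : c ≠ 0) (hX : X ≠ 0) (h1 : q * (q ^ j) ^ 2 - X * q ^ k ≠ 0)
    (h2 : q * (q ^ j) ^ 2 - X ^ 2 ≠ 0) (h3 : q ^ j + X ≠ 0) (h4 : q * q ^ j + X ≠ 0) :
    stepUp q a c j X * (newtonNum q j (q * X) (k + 1) - newtonNum q j X (k + 1))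
      + stepDown q a c j X * (newtonNum q j (X / q) (k + 1) - newtonNum q j X (k + 1))
    = newtonDen q a c j k * newtonNum q j X k
      + (lattice q a c (2 * (k + 1)) - lattice q a c 0) * newtonNum q j X (k + 1) := by
  have e0 : newtonNum q j X k
      = newtonCommon q j X k * ((q * (q ^ j) ^ 2 - X) / (q * (q ^ j) ^ 2 - X * q ^ k)) := by
    field_simp
    linear_combination newtonNum_mul q j X k
  -- The factor `X - 1` is kept, since `X = 1` (degree `0`) must be allowed; `stepDown` supplies it.
  have e1 : newtonNum q j (X / q) (k + 1) * (X - 1)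
      = newtonCommon q j X k * ((q * (q ^ j) ^ 2 - X / q) * (q * (q ^ j) ^ 2 - X)
        * (X - q ^ k) * (X - q ^ (k + 1)) / X) / (q * (q ^ j) ^ 2 - X * q ^ k) := by
    rw [eq_div_iff h1, mul_assoc, newtonNum_down q j hq hX k]
  have e2 : stepDown q a c j X * newtonNum q j (X / q) (k + 1)
      = -((a * q * q ^ j - c * X) * (a * c * (q * (q ^ j) ^ 2) - X)
        / (2 * a * c * (q * q ^ j + X) * (q * (q ^ j) ^ 2 - X ^ 2)))
        * (newtonNum q j (X / q) (k + 1) * (X - 1)) := by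
    rw [stepDown]
    ring
  rw [mul_sub (stepDown q a c j X), e2, e1, e0, newtonNum_up q j hq hX, newtonNum_succ q j X]
  have l0 : lattice q a c 0 = (a⁻¹ + a) / 2 := by simpa using lattice_even q a c 0
  rw [lattice_even, l0, stepUp, stepDown, newtonDen]
  generalize newtonCommon q j X k = E
  rw [pow_succ q k]
  have hK : q ^ k ≠ 0 := pow_ne_zero _ hq
  generalize q ^ k = K at *
  generalize q ^ j = J at *
  clear e0 e1 e2
  generalize hP : q * J ^ 2 - X * K = P at *
  generalize hS : q * J ^ 2 - X ^ 2 = S at *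
  generalize hT : J + X = T at *
  generalize hV : q * J + X = V at *
  field_simp
  subst hP hS hT hV
  ring

theorem Admissible.newtonDen_ne {j : ℕ} {q a c : ℝ} (h : Admissible j q a c) {i : ℕ}
    (hi : i < j) : newtonDen q a c j i ≠ 0 := by
  have h1 := sub_ne_zero.2 (h.pow_ne_one (Nat.succ_ne_zero i)).symm
  have h2 := sub_ne_zero.2 (h.pow_ne_pow hi.ne')
  have h3 := sub_ne_zero.2 (h.mul_pow_ne_one (i := i) (by omega)).symm
  have h4 := sub_ne_zero.2 (h.mul_pow_ne_mul_pow i j).symm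
  have ha := h.a_ne
  have hc := h.c_ne
  have hq := pow_ne_zero i h.q_ne
  rw [newtonDen]
  refine div_ne_zero (neg_ne_zero.2 ?_) ?_ <;> simp_all

theorem sub_mul_newtonBasis (q a c : ℝ) (k : ℕ) (x : ℝ) :
    (x - lattice q a c (2 * k)) * newtonBasis q a c k x = newtonBasis q a c (k + 1) x := by
  rw [newtonBasis, newtonBasis, Finset.prod_range_succ, mul_comm]

/-- Expand `x - x_0` as `(x - x_{2k}) + (x_{2k} - x_0)` on the `k`-th basis element and compare
coefficients. The first summand on the right is the boundary term of the truncation: `newtonDen`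
vanishes at `i = j`, so no further coefficient can absorb it. -/
theorem sub_mul_newtonSum {j : ℕ} {q a c : ℝ} (h : Admissible j q a c) {n : ℕ} (hn : n ≤ j)
    (x : ℝ) :
    (x - lattice q a c 0) * newtonSum q a c j (q ^ n) x
      = newtonCoeff q a c j (q ^ n) j * newtonBasis q a c (j + 1) x
        + stepUp q a c j (q ^ n)
          * (newtonSum q a c j (q * q ^ n) x - newtonSum q a c j (q ^ n) x)
        + stepDown q a c j (q ^ n)
          * (newtonSum q a c j (q ^ n / q) x - newtonSum q a c j (q ^ n) x) := by
  have hq := h.q_pos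
  have key : ∀ k < j, stepUp q a c j (q ^ n)
        * (newtonCoeff q a c j (q * q ^ n) (k + 1) - newtonCoeff q a c j (q ^ n) (k + 1))
      + stepDown q a c j (q ^ n)
        * (newtonCoeff q a c j (q ^ n / q) (k + 1) - newtonCoeff q a c j (q ^ n) (k + 1))
      = newtonCoeff q a c j (q ^ n) k
        + (lattice q a c (2 * (k + 1)) - lattice q a c 0)
          * newtonCoeff q a c j (q ^ n) (k + 1) := by
    intro k hk
    have e1 : q * (q ^ j) ^ 2 - q ^ n * q ^ k ≠ 0 := by
      have := h.pow_ne_pow (show 2 * j + 1 ≠ n + k by omega)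
      rw [← sub_ne_zero] at this
      convert this using 1
      ring
    have e2 : q * (q ^ j) ^ 2 - (q ^ n) ^ 2 ≠ 0 := by
      have := h.pow_ne_pow (show 2 * j + 1 ≠ 2 * n by omega)
      rw [← sub_ne_zero] at this
      convert this using 1
      ring
    have e := newtonNum_difference_eq hq.ne' h.a_ne h.c_ne (pow_ne_zero n hq.ne') e1 e2
      (by positivity) (by positivity)
    have hd := h.newtonDen_ne hk
    have hp : ∏ i ∈ Finset.range k, newtonDen q a c j i ≠ 0 :=
      Finset.prod_ne_zero_iff.2 fun i hi =>
        h.newtonDen_ne ((Finset.mem_range.1 hi).trans hk)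
    simp only [newtonCoeff, Finset.prod_range_succ]
    generalize q ^ n / q = Z at *
    generalize q * q ^ n = W at *
    field_simp
    linear_combination e
  have key' : ∀ Z, newtonCoeff q a c j Z 0 = 1 := by simp [newtonCoeff, newtonNum]
  have split : ∀ Z, newtonSum q a c j Z x
      = ∑ k ∈ Finset.range j, newtonCoeff q a c j Z (k + 1) * newtonBasis q a c (k + 1) x
        + 1 := by
    intro Z
    rw [newtonSum, Finset.sum_range_succ', key']
    simp [newtonBasis]
  have lhs : (x - lattice q a c 0) * newtonSum q a c j (q ^ n) x
      = newtonCoeff q a c j (q ^ n) j * newtonBasis q a c (j + 1) x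
        + ∑ k ∈ Finset.range j, (newtonCoeff q a c j (q ^ n) k
            + (lattice q a c (2 * (k + 1)) - lattice q a c 0)
              * newtonCoeff q a c j (q ^ n) (k + 1)) * newtonBasis q a c (k + 1) x := by
    have e1 : (x - lattice q a c 0) * newtonSum q a c j (q ^ n) x
        = ∑ k ∈ Finset.range (j + 1),
            (newtonCoeff q a c j (q ^ n) k * newtonBasis q a c (k + 1) x
              + (lattice q a c (2 * k) - lattice q a c 0)
                * newtonCoeff q a c j (q ^ n) k * newtonBasis q a c k x) := by
      rw [newtonSum, Finset.mul_sum]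
      refine Finset.sum_congr rfl fun k _ => ?_
      rw [← sub_mul_newtonBasis]
      ring
    rw [e1, Finset.sum_add_distrib, Finset.sum_range_succ,
      Finset.sum_range_succ' (fun k => (lattice q a c (2 * k) - lattice q a c 0)
                * newtonCoeff q a c j (q ^ n) k * newtonBasis q a c k x)]
    simp only [add_mul, Finset.sum_add_distrib]
    simp
    ring
  rw [lhs, Finset.sum_congr rfl fun k hk => by rw [← key k (Finset.mem_range.1 hk)]]
  simp only [split, add_mul, Finset.sum_add_distrib, mul_assoc, ← Finset.mul_sum, sub_mul,
    Finset.sum_sub_distrib]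
  ring

theorem bCoeff_eq_lattice_sub {j : ℕ} {q a c : ℝ} (h : Admissible j q a c) (α : ℝ) {n : ℕ}
    (hn : n < j) : bCoeff q a c α j n
      = lattice q a c 0 - stepUp q a c j (q ^ n) - stepDown q a c j (q ^ n) := by
  have l0 : lattice q a c 0 = (a⁻¹ + a) / 2 := by simpa using lattice_even q a c 0
  have hq := h.q_pos
  have ha := h.a_ne
  have hc := h.c_ne
  have e2 : q * (q ^ j) ^ 2 - (q ^ n) ^ 2 ≠ 0 := by
    have := h.pow_ne_pow (show 2 * j + 1 ≠ 2 * n by omega)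
    rw [← sub_ne_zero] at this
    convert this using 1
    ring
  have e3 : q ^ j + q ^ n ≠ 0 := by positivity
  have e4 : q * q ^ j + q ^ n ≠ 0 := by positivity
  rw [bCoeff, if_neg (by omega), if_neg (by omega), l0, stepUp, stepDown, pow_succ' q j]
  generalize q ^ j = J at *
  generalize q ^ n = X at *
  generalize hS : q * J ^ 2 - X ^ 2 = S at *
  generalize hT : J + X = T at *
  generalize hV : q * J + X = V at *
  field_simp
  subst hS hT hV
  ring

/-- Unlike the formula for `n < j`, this has no `stepUp` term: at `n = j` the difference that it
multiplies is zero by `newtonSum_reflect`. -/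
theorem bCoeff_zero_eq {j : ℕ} {q a c : ℝ} (h : Admissible j q a c) :
    bCoeff q a c 0 j j = lattice q a c 0 - stepDown q a c j (q ^ j) := by
  have l0 : lattice q a c 0 = (a⁻¹ + a) / 2 := by simpa using lattice_even q a c 0
  have hq := h.q_pos
  have ha := h.a_ne
  have hc := h.c_ne
  have e1 : q ^ 2 - 1 ≠ 0 := sub_ne_zero.2 (h.pow_ne_one two_ne_zero)
  have e2 : q * (q ^ j) ^ 2 - (q ^ j) ^ 2 = (q ^ 2 - 1) * (q ^ j) ^ 2 / (q + 1) := by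
    field_simp
    ring
  have e4 : q * q ^ j + q ^ j = (q + 1) * q ^ j := by ring
  rw [bCoeff, if_pos rfl, l0, stepDown, zpow_neg_eq, pow_succ' q j, e2, e4]
  have hJ : 0 < q ^ j := by positivity
  have hq1 : q + 1 ≠ 0 := by positivity
  generalize q ^ j = J at *
  generalize hS : q ^ 2 - 1 = S at *
  generalize hT : q + 1 = T at *
  field_simp
  ring

theorem uCoeff_succ_eq {j : ℕ} {q a c : ℝ} (h : Admissible j q a c) (α : ℝ) {n : ℕ}
    (hn : n < j) : uCoeff q a c α j (n + 1)
      = stepUp q a c j (q ^ n) * stepDown q a c j (q ^ (n + 1)) := by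
  have hq := h.q_pos
  have ha := h.a_ne
  have hc := h.c_ne
  have hX : 0 < q ^ n := by positivity
  have e2 : q * (q ^ j) ^ 2 - (q ^ n) ^ 2 ≠ 0 := by
    have := h.pow_ne_pow (show 2 * j + 1 ≠ 2 * n by omega)
    rw [← sub_ne_zero] at this
    convert this using 1
    ring
  have e5 : (q ^ j) ^ 2 - q * (q ^ n) ^ 2 ≠ 0 := by
    have := h.pow_ne_pow (show 2 * j ≠ 2 * n + 1 by omega)
    rw [← sub_ne_zero] at this
    convert this using 1
    ring
  have e3 : q ^ j + q ^ n ≠ 0 := by positivity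
  have f1 : q ^ (2 * (n + 1)) - q ^ (2 * j + 1) = -(q * ((q ^ j) ^ 2 - q * (q ^ n) ^ 2)) := by ring
  have f2 : q ^ (2 * (n + 1)) - q ^ (2 * j + 3)
      = -(q ^ 2 * (q * (q ^ j) ^ 2 - (q ^ n) ^ 2)) := by ring
  have f3 : q ^ (j + 1) + q ^ (n + 1) = q * (q ^ j + q ^ n) := by ring
  have f4 : q * (q ^ j) ^ 2 - (q ^ (n + 1)) ^ 2 = q * ((q ^ j) ^ 2 - q * (q ^ n) ^ 2) := by ring
  have f5 : q * q ^ j + q ^ (n + 1) = q * (q ^ j + q ^ n) := by ring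
  have f6 : q ^ (2 * j + 1) = q * (q ^ j) ^ 2 := by ring
  have f7 : q ^ (2 * j + 2) = q ^ 2 * (q ^ j) ^ 2 := by ring
  rw [uCoeff, if_neg (by omega), stepUp, stepDown, f1, f2, f3, f4, f5, f6, f7, pow_succ' q n,
    pow_succ' q j]
  generalize q ^ j = J at *
  generalize q ^ n = X at *
  generalize hS : q * J ^ 2 - X ^ 2 = S at *
  generalize hT : J + X = T at *
  generalize hV : J ^ 2 - q * X ^ 2 = V at *
  field_simp
  ring

/-- The product of the `A_i`, `i < n`. -/
noncomputable def stepUpProd (q a c : ℝ) (j n : ℕ) : ℝ :=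
  ∏ i ∈ Finset.range n, stepUp q a c j (q ^ i)

theorem newtonNum_eq_zero (q : ℝ) {j n k : ℕ} (hk : n < k) : newtonNum q j (q ^ n) k = 0 :=
  Finset.prod_eq_zero (Finset.mem_range.2 hk) (by simp)

theorem newtonSum_one (q a c : ℝ) (j : ℕ) (x : ℝ) : newtonSum q a c j 1 x = 1 := by
  rw [newtonSum, Finset.sum_range_succ', Finset.sum_eq_zero]
  · simp [newtonCoeff, newtonNum, newtonBasis]
  · intro k _
    have := newtonNum_eq_zero q (j := j) (Nat.succ_pos k)
    rw [pow_zero] at this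
    rw [newtonCoeff, this]
    simp

theorem stepDown_one (q a c : ℝ) (j : ℕ) : stepDown q a c j 1 = 0 := by simp [stepDown]

theorem eval_R_zero (q a c α : ℝ) (j : ℕ) (x : ℝ) : (R q a c α j 0).eval x = 1 := by
  simp [R]

theorem eval_R_one (q a c α : ℝ) (j : ℕ) (x : ℝ) :
    (R q a c α j 1).eval x = x - bCoeff q a c α j 0 := by
  simp [R]

theorem eval_R_succ_succ (q a c α : ℝ) (j n : ℕ) (x : ℝ) :
    (R q a c α j (n + 2)).eval x
      = (x - bCoeff q a c α j (n + 1)) * (R q a c α j (n + 1)).eval x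
        - uCoeff q a c α j (n + 1) * (R q a c α j n).eval x := by
  simp [R]

theorem newtonSum_step {j : ℕ} {q a c : ℝ} (h : Admissible j q a c) {n : ℕ} (hn : n < j)
    (x : ℝ) :
    stepUp q a c j (q ^ n) * newtonSum q a c j (q ^ (n + 1)) x
      = (x - lattice q a c 0 + stepUp q a c j (q ^ n) + stepDown q a c j (q ^ n))
          * newtonSum q a c j (q ^ n) x
        - stepDown q a c j (q ^ n) * newtonSum q a c j (q ^ n / q) x := by
  have e := sub_mul_newtonSum h hn.le x
  rw [newtonCoeff, newtonNum_eq_zero q hn, ← pow_succ'] at e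
  linear_combination -e

theorem eval_R_eq_newtonSum {j : ℕ} {q a c : ℝ} (h : Admissible j q a c) (α : ℝ) {n : ℕ}
    (hn : n ≤ j) (x : ℝ) :
    (R q a c α j n).eval x = stepUpProd q a c j n * newtonSum q a c j (q ^ n) x := by
  induction n using Nat.twoStepInduction with
  | zero => simp [stepUpProd, newtonSum_one, eval_R_zero]
  | one =>
    have e := newtonSum_step h hn x
    rw [eval_R_one, bCoeff_eq_lattice_sub h α hn, stepUpProd, Finset.prod_range_one]
    rw [pow_zero, newtonSum_one, stepDown_one] at e
    rw [zero_add] at e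
    rw [pow_zero, e, stepDown_one]
    ring
  | more n ih1 ih2 =>
    have e : stepUp q a c j (q ^ (n + 1)) * newtonSum q a c j (q ^ (n + 2)) x = _ :=
      newtonSum_step h (show n + 1 < j by omega) x
    have e' : q ^ (n + 1) / q = q ^ n := by
      have := h.q_ne
      field_simp
      ring
    rw [e'] at e
    rw [eval_R_succ_succ, ih1 (by omega), ih2 (by omega), bCoeff_eq_lattice_sub h α (by omega),
      uCoeff_succ_eq h α (by omega)]
    rw [stepUpProd, stepUpProd, stepUpProd, Finset.prod_range_succ _ (n + 1),
      Finset.prod_range_succ _ n]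
    linear_combination
      -(∏ i ∈ Finset.range n, stepUp q a c j (q ^ i)) * stepUp q a c j (q ^ n) * e

/-- `newtonNum` is invariant under `X ↦ q^(2j+1) / X`, which exchanges `q^j` and `q^(j+1)`. -/
theorem newtonSum_reflect (q a c : ℝ) (hq : q ≠ 0) (j : ℕ) (x : ℝ) :
    newtonSum q a c j (q * q ^ j) x = newtonSum q a c j (q ^ j) x := by
  refine Finset.sum_congr rfl fun k _ => ?_
  have : newtonNum q j (q * q ^ j) k = newtonNum q j (q ^ j) k := by
    refine Finset.prod_congr rfl fun i _ => ?_
    have := pow_ne_zero j hq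
    field_simp
  rw [newtonCoeff, this, newtonCoeff]

/-- For `α = 0` the polynomial `R_{j+1}` is proportional to the Newton basis polynomial. -/
theorem eval_R_zero_succ {j : ℕ} {q a c : ℝ} (h : Admissible j q a c) (x : ℝ) :
    (R q a c 0 j (j + 1)).eval x
      = stepUpProd q a c j j * newtonCoeff q a c j (q ^ j) j * newtonBasis q a c (j + 1) x := by
  have e := sub_mul_newtonSum h le_rfl x
  -- With the upward difference gone, the identity becomes the recurrence for `R_{j+1}` at `α = 0`,
  -- the boundary term playing the part of `R_{j+1}`.
  rw [newtonSum_reflect q a c h.q_ne, sub_self, mul_zero, add_zero] at e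
  cases j with
  | zero =>
    have hb := bCoeff_zero_eq h
    rw [pow_zero] at hb
    rw [eval_R_one, hb, stepUpProd, Finset.prod_range_zero, one_mul]
    rw [pow_zero, newtonSum_one] at e
    rw [stepDown_one] at e ⊢
    rw [pow_zero]
    linear_combination e
  | succ j =>
    have e' : q ^ (j + 1) / q = q ^ j := by
      have := h.q_ne
      field_simp
      ring
    rw [e'] at e
    rw [eval_R_succ_succ, eval_R_eq_newtonSum h 0 le_rfl, eval_R_eq_newtonSum h 0 (by omega),
      bCoeff_zero_eq h, uCoeff_succ_eq h 0 (by omega)]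
    have e2 : stepUpProd q a c (j + 1) (j + 1)
        = stepUpProd q a c (j + 1) j * stepUp q a c (j + 1) (q ^ j) := Finset.prod_range_succ _ _
    rw [e2]
    linear_combination stepUpProd q a c (j + 1) j * stepUp q a c (j + 1) (q ^ j) * e

/-! ### Degrees, and the dependence on `α` in the middle -/

theorem R_monic_natDegree (q a c α : ℝ) (j n : ℕ) :
    (R q a c α j n).Monic ∧ (R q a c α j n).natDegree = n := by
  induction n using Nat.twoStepInduction with
  | zero => simp [R]
  | one =>
    rw [R]
    exact ⟨monic_X_sub_C _, natDegree_X_sub_C _⟩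
  | more n ih1 ih2 =>
    have hm : ((X - C (bCoeff q a c α j (n + 1))) * R q a c α j (n + 1)).Monic :=
      (monic_X_sub_C _).mul ih2.1
    have hd : ((X - C (bCoeff q a c α j (n + 1))) * R q a c α j (n + 1)).natDegree = n + 2 := by
      rw [(monic_X_sub_C _).natDegree_mul ih2.1, natDegree_X_sub_C, ih2.2]
      ring
    have hlt : (C (uCoeff q a c α j (n + 1)) * R q a c α j n).natDegree
        < ((X - C (bCoeff q a c α j (n + 1))) * R q a c α j (n + 1)).natDegree := by
      have := natDegree_C_mul_le (uCoeff q a c α j (n + 1)) (R q a c α j n)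
      omega
    rw [R]
    exact ⟨hm.sub_of_left (degree_lt_degree hlt),
      (natDegree_sub_eq_left_of_natDegree_lt hlt).trans hd⟩

/-- The monic polynomial with zeros at the even lattice points. -/
noncomputable def evenPoly (q a c : ℝ) (j : ℕ) : ℝ[X] :=
  ∏ s ∈ Finset.range (j + 1), (X - C (lattice q a c (2 * s)))

/-- The two sides are proportional and both monic, so the constant need not be computed. -/
theorem R_zero_succ {j : ℕ} {q a c : ℝ} (h : Admissible j q a c) :
    R q a c 0 j (j + 1) = evenPoly q a c j := by
  have hm : (evenPoly q a c j).Monic := monic_prod_of_monic _ _ fun _ _ => monic_X_sub_C _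
  have e : R q a c 0 j (j + 1)
      = C (stepUpProd q a c j j * newtonCoeff q a c j (q ^ j) j) * evenPoly q a c j := by
    refine Polynomial.funext fun x => ?_
    rw [eval_R_zero_succ h, eval_mul, eval_C, evenPoly, eval_prod, newtonBasis]
    simp
  have hl := (R_monic_natDegree q a c 0 j (j + 1)).1.leadingCoeff
  rw [e, leadingCoeff_mul, leadingCoeff_C, hm.leadingCoeff, mul_one] at hl
  rw [e, hl, C_1, one_mul]

/-- The difference of the values of `b_j` at `α = 1` and `α = 0`. -/
noncomputable def bJump (q a c : ℝ) (j : ℕ) : ℝ :=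
  (c - a) * (q ^ (j + 1) - 1) * q ^ (-(j : ℤ)) * (a * c * q ^ j - 1) / (2 * a * c * (q - 1))

theorem bCoeff_mid (q a c α : ℝ) (j : ℕ) :
    bCoeff q a c α j j = bCoeff q a c 0 j j + α * bJump q a c j := by
  simp only [bCoeff, if_true, bJump]
  ring

theorem bCoeff_mid_succ (q a c α : ℝ) (j : ℕ) :
    bCoeff q a c α j (j + 1) = bCoeff q a c (1 - α) j j := by
  simp [bCoeff]

theorem uCoeff_mid (q a c α : ℝ) (j : ℕ) :
    uCoeff q a c α j (j + 1) = α * (1 - α) * bJump q a c j ^ 2 := by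
  have : q ^ (-(2 * (j : ℤ))) = (q ^ (-(j : ℤ))) ^ 2 := by
    rw [← zpow_natCast, ← zpow_mul]
    congr 1
    push_cast
    ring
  rw [uCoeff, if_pos rfl, bJump, this, div_pow, ← mul_div_assoc]
  congr 1 <;> ring

theorem Admissible.bJump_ne {j : ℕ} {q a c : ℝ} (h : Admissible j q a c) :
    bJump q a c j ≠ 0 := by
  have h1 := sub_ne_zero.2 (h.pow_ne_one (Nat.succ_ne_zero j))
  have h2 := sub_ne_zero.2 (h.mul_pow_ne_one (i := j) (by omega))
  have h3 := sub_ne_zero.2 h.ne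
  have h4 := sub_ne_zero.2 h.q_lt_one.ne
  have h5 := zpow_ne_zero (-(j : ℤ)) h.q_ne
  have ha := h.a_ne
  have hc := h.c_ne
  rw [bJump]
  refine div_ne_zero ?_ ?_ <;> simp_all

theorem bCoeff_congr (q a c α β : ℝ) {j n : ℕ} (h1 : n ≠ j) (h2 : n ≠ j + 1) :
    bCoeff q a c α j n = bCoeff q a c β j n := by
  simp [bCoeff, h1, h2]

theorem uCoeff_congr (q a c α β : ℝ) {j n : ℕ} (h1 : n ≠ j + 1) :
    uCoeff q a c α j n = uCoeff q a c β j n := by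
  simp [uCoeff, h1]

theorem R_congr (q a c α β : ℝ) {j n : ℕ} (hn : n ≤ j) : R q a c α j n = R q a c β j n := by
  induction n using Nat.twoStepInduction with
  | zero => simp [R]
  | one => rw [R, R, bCoeff_congr q a c α β (by omega) (by omega)]
  | more n ih1 ih2 =>
    rw [R, R, bCoeff_congr q a c α β (by omega) (by omega), uCoeff_congr q a c α β (by omega),
      ih1 (by omega), ih2 (by omega)]

/-- Of the coefficients that build `R_{j+1}`, only `b_j` involves `α`; `u_{j+1}` enters first in
degree `j + 2`. -/
theorem R_mid_succ (q a c α : ℝ) (j : ℕ) :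
    R q a c α j (j + 1)
      = R q a c 0 j (j + 1) - C (α * bJump q a c j) * R q a c 0 j j := by
  cases j with
  | zero =>
    rw [R, R, R, bCoeff_mid]
    simp
    ring
  | succ j =>
    rw [R, R, bCoeff_mid, uCoeff_congr q a c α 0 (by omega), R_congr q a c α 0 le_rfl,
      R_congr q a c α 0 (by omega), C_add]
    ring

/-! ### Symmetry under `a ↔ c`, `α ↔ 1 - α` -/

section Swap

variable {j : ℕ} {q a c : ℝ}

theorem bCoeff_swap (h : Admissible j q a c) (α : ℝ) (n : ℕ) :
    bCoeff q c a α j n = bCoeff q a c (1 - α) j n := by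
  have ha := h.a_ne
  have hc := h.c_ne
  have hq := h.q_ne
  have main : ∀ β, bCoeff q c a β j j = bCoeff q a c (1 - β) j j := by
    intro β
    have h1 := sub_ne_zero.2 h.q_lt_one.ne
    have h2 : q + 1 ≠ 0 := by linarith [h.q_pos]
    have h3 : q ^ 2 - 1 = (q - 1) * (q + 1) := by ring
    simp only [bCoeff, if_true, zpow_neg_eq, h3, pow_succ' q j]
    have hJ := pow_ne_zero j hq
    generalize q ^ j = J at *
    clear h3
    field_simp
    ring
  by_cases h1 : n = j
  · subst h1
    exact main α
  by_cases h2 : n = j + 1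
  · subst h2
    rw [bCoeff_mid_succ, bCoeff_mid_succ, main]
  simp only [bCoeff, h1, h2, if_false]
  congr 1 <;> ring

theorem uCoeff_swap (q a c α : ℝ) (j n : ℕ) :
    uCoeff q c a α j n = uCoeff q a c (1 - α) j n := by
  by_cases h2 : n = j + 1
  · simp only [uCoeff, h2, if_true]
    congr 1 <;> ring
  · simp only [uCoeff, h2, if_false]
    congr 1 <;> ring

theorem R_swap (h : Admissible j q a c) (α : ℝ) (n : ℕ) :
    R q c a α j n = R q a c (1 - α) j n := by
  induction n using Nat.twoStepInduction with
  | zero => simp [R]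
  | one => rw [R, R, bCoeff_swap h]
  | more n ih1 ih2 => rw [R, R, bCoeff_swap h, uCoeff_swap, ih1, ih2]

theorem R_one_succ (h : Admissible j q a c) : R q a c 1 j (j + 1) = evenPoly q c a j := by
  rw [← R_zero_succ h.symm, R_swap h, sub_zero]

/-- Compare `R_{j+1}` at `α = 0` and `α = 1`; `R_j` is the same for both. -/
theorem bJump_mul_R (h : Admissible j q a c) (α : ℝ) :
    C (bJump q a c j) * R q a c α j j = evenPoly q a c j - evenPoly q c a j := by
  have := R_mid_succ q a c 1 j
  rw [R_one_succ h, R_zero_succ h, one_mul] at this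
  rw [this, R_congr q a c α 0 le_rfl]
  ring

theorem R_mid_succ_eq (h : Admissible j q a c) (α : ℝ) :
    R q a c α j (j + 1) = C (1 - α) * evenPoly q a c j + C α * evenPoly q c a j := by
  rw [R_mid_succ, R_zero_succ h, C_mul, mul_assoc, bJump_mul_R h, C_sub, C_1]
  ring

end Swap

/-! ### Index reversal and factorization of `R_{N+1}` -/

section Reversal

theorem R_succ_succ (q a c α : ℝ) (j n : ℕ) :
    R q a c α j (n + 2) = (X - C (bCoeff q a c α j (n + 1))) * R q a c α j (n + 1)
      - C (uCoeff q a c α j (n + 1)) * R q a c α j n := rfl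

variable {j : ℕ} {q a c : ℝ}

/-- Away from the middle, the formula is invariant under `q^n ↦ q^(2j+1) / q^n`. In the middle,
reversal exchanges `b_j` and `b_{j+1}`, hence `α` and `1 - α`. -/
theorem bCoeff_reverse (h : Admissible j q a c) (α : ℝ) {n m : ℕ} (hnm : n + m = 2 * j + 1) :
    bCoeff q a c α j n = bCoeff q a c (1 - α) j m := by
  by_cases h1 : n = j
  · obtain rfl : m = j + 1 := by omega
    subst h1
    rw [bCoeff_mid_succ, sub_sub_cancel]
  by_cases h2 : n = j + 1
  · obtain rfl : m = j := by omega
    rw [h2, bCoeff_mid_succ]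
  have h3 : m ≠ j := by omega
  have h4 : m ≠ j + 1 := by omega
  simp only [bCoeff, h1, h2, h3, h4, if_false]
  have hq := h.q_pos
  have ha := h.a_ne
  have hc := h.c_ne
  have hJ : 0 < q ^ j := by positivity
  have hX : 0 < q ^ n := by positivity
  have e : q ^ m = q * (q ^ j) ^ 2 / q ^ n := by
    rw [eq_div_iff hX.ne', ← pow_add, add_comm m n, hnm]
    ring
  rw [e, pow_succ' q j]
  generalize q ^ j = J at *
  generalize q ^ n = X at *
  have e1 : J + q * J ^ 2 / X = J * (X + q * J) / X := by field_simp
  have e2 : q * J + q * J ^ 2 / X = q * J * (X + J) / X := by field_simp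
  rw [e1, e2]
  have h5 : X + q * J ≠ 0 := by positivity
  have h6 : X + J ≠ 0 := by positivity
  have e3 : J + X = X + J := by ring
  have e4 : q * J + X = X + q * J := by ring
  rw [e3, e4]
  generalize X + q * J = V at *
  generalize X + J = W at *
  field_simp

theorem uCoeff_reverse (h : Admissible j q a c) (α : ℝ) {n m : ℕ} (hnm : n + m = 2 * j + 2) :
    uCoeff q a c α j n = uCoeff q a c (1 - α) j m := by
  by_cases h2 : n = j + 1
  · obtain rfl : m = j + 1 := by omega
    rw [h2, uCoeff_mid, uCoeff_mid]
    ring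
  have h4 : m ≠ j + 1 := by omega
  simp only [uCoeff, h2, h4, if_false]
  have hq := h.q_pos
  have ha := h.a_ne
  have hc := h.c_ne
  have hJ : 0 < q ^ j := by positivity
  have hX : 0 < q ^ n := by positivity
  have e : q ^ m = q ^ 2 * (q ^ j) ^ 2 / q ^ n := by
    rw [eq_div_iff hX.ne', ← pow_add, add_comm m n, hnm]
    ring
  have n1 : (q ^ n) ^ 2 - q * (q ^ j) ^ 2 ≠ 0 := by
    have := sub_ne_zero.2 (h.pow_ne_pow (show 2 * n ≠ 2 * j + 1 by omega))
    convert this using 1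
    ring
  have n2 : (q ^ n) ^ 2 - q ^ 3 * (q ^ j) ^ 2 ≠ 0 := by
    have := sub_ne_zero.2 (h.pow_ne_pow (show 2 * n ≠ 2 * j + 3 by omega))
    convert this using 1
    ring
  have p1 : ∀ k : ℕ, q ^ (2 * k) = (q ^ k) ^ 2 := fun k => by ring
  have p2 : q ^ (2 * j + 1) = q * (q ^ j) ^ 2 := by ring
  have p3 : q ^ (2 * j + 2) = q ^ 2 * (q ^ j) ^ 2 := by ring
  have p4 : q ^ (2 * j + 3) = q ^ 3 * (q ^ j) ^ 2 := by ring
  rw [p1, p1, p2, p3, p4, e, pow_succ' q j]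
  generalize q ^ j = J at *
  generalize q ^ n = X at *
  have e1 : q * J + q ^ 2 * J ^ 2 / X = q * J * (q * J + X) / X := by field_simp; ring
  have e2 : (q ^ 2 * J ^ 2 / X) ^ 2 - q * J ^ 2
      = -(q * J ^ 2 * (X ^ 2 - q ^ 3 * J ^ 2)) / X ^ 2 := by field_simp; ring
  have e3 : (q ^ 2 * J ^ 2 / X) ^ 2 - q ^ 3 * J ^ 2
      = -(q ^ 3 * J ^ 2 * (X ^ 2 - q * J ^ 2)) / X ^ 2 := by field_simp; ring
  rw [e1, e2, e3]
  have h5 : q * J + X ≠ 0 := by positivity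
  generalize q * J + X = V at *
  generalize X ^ 2 - q ^ 3 * J ^ 2 = W at *
  generalize X ^ 2 - q * J ^ 2 = T at *
  field_simp
  ring

/-- Expansion of the tridiagonal determinant along a cut: the lower block, read backwards, is a
leading block of the family with `1 - α`. -/
theorem R_eq_reverse (h : Admissible j q a c) (α : ℝ) {n m : ℕ} (hnm : n + m = 2 * j) :
    R q a c α j (2 * j + 2)
      = R q a c α j (n + 1) * R q a c (1 - α) j (m + 1)
        - C (uCoeff q a c α j (n + 1)) * R q a c α j n * R q a c (1 - α) j m := by
  induction m generalizing n with
  | zero =>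
    obtain rfl : n = 2 * j := by omega
    rw [R_succ_succ, bCoeff_reverse h α (m := 0) (by omega), zero_add, R, R, mul_one]
    ring
  | succ m ih =>
    rw [ih (n := n + 1) (by omega), R, R, bCoeff_reverse h α (n := n + 1) (m := m + 1) (by omega),
      uCoeff_reverse h α (n := n + 1 + 1) (m := m + 1) (by omega)]
    ring

theorem R_last (h : Admissible j q a c) (α : ℝ) :
    R q a c α j (2 * j + 2) = evenPoly q a c j * evenPoly q c a j := by
  rw [R_eq_reverse h α (n := j) (m := j) (by omega), R_mid_succ_eq h, R_mid_succ_eq h, uCoeff_mid]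
  have e1 := bJump_mul_R h α
  have e2 := bJump_mul_R h (1 - α)
  simp only [C_sub, C_mul, C_pow, C_1]
  linear_combination (-C α * (1 - C α)) * (C (bJump q a c j) * R q a c (1 - α) j j * e1
    + (evenPoly q a c j - evenPoly q c a j) * e2)

theorem uProd_succ (q a c α : ℝ) (j n : ℕ) :
    uProd q a c α j (n + 1) = uProd q a c α j n * uCoeff q a c α j (n + 1) :=
  Finset.prod_Icc_succ_top (by omega) _

theorem uProd_zero (q a c α : ℝ) (j : ℕ) : uProd q a c α j 0 = 1 := by simp [uProd]

theorem uProd_congr (q a c α β : ℝ) {j n : ℕ} (hn : n ≤ j) :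
    uProd q a c α j n = uProd q a c β j n :=
  Finset.prod_congr rfl fun k hk =>
    uCoeff_congr q a c α β (by have := Finset.mem_Icc.1 hk; omega)

theorem uProd_mul_reverse (h : Admissible j q a c) (α : ℝ) {n m : ℕ} (hnm : n + m = 2 * j + 1) :
    uProd q a c α j n * uProd q a c (1 - α) j m = uProd q a c α j (2 * j + 1) := by
  induction m generalizing n with
  | zero =>
    obtain rfl : n = 2 * j + 1 := by omega
    rw [uProd_zero, mul_one]
  | succ m ih =>
    rw [← ih (n := n + 1) (by omega), uProd_succ, uProd_succ,
      uCoeff_reverse h α (n := n + 1) (m := m + 1) (by omega)]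
    ring

theorem uProd_last (h : Admissible j q a c) (α : ℝ) :
    uProd q a c α j (2 * j + 1)
      = α * (1 - α) * bJump q a c j ^ 2 * uProd q a c 0 j j ^ 2 := by
  rw [← uProd_mul_reverse h α (n := j) (m := j + 1) (by omega), uProd_succ, uCoeff_mid,
    uProd_congr q a c α 0 le_rfl, uProd_congr q a c (1 - α) 0 le_rfl]
  ring

/-- When `R_{N+1}(x) = 0`, the recurrence run downwards from degree `N` is, by reversal, the
recurrence of the family with `1 - α`, started at `R_N(x)` and rescaled by the products of `u`. -/
theorem eval_R_mul_uProd (h : Admissible j q a c) (α : ℝ) {x : ℝ}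
    (hx : (R q a c α j (2 * j + 2)).eval x = 0) {n m : ℕ} (hnm : n + m = 2 * j + 1) :
    (R q a c α j n).eval x * uProd q a c (1 - α) j m
      = (R q a c α j (2 * j + 1)).eval x * (R q a c (1 - α) j m).eval x := by
  induction m using Nat.twoStepInduction generalizing n with
  | zero =>
    obtain rfl : n = 2 * j + 1 := by omega
    rw [uProd_zero, eval_R_zero]
  | one =>
    obtain rfl : n = 2 * j := by omega
    rw [eval_R_succ_succ, bCoeff_reverse h α (m := 0) (by omega),
      uCoeff_reverse h α (m := 1) (by omega)] at hx
    rw [uProd_succ, uProd_zero, eval_R_one, zero_add]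
    linear_combination -hx
  | more m ih1 ih2 =>
    have e1 := ih1 (n := n + 2) (by omega)
    have e2 := ih2 (n := n + 1) (by omega)
    have e3 := eval_R_succ_succ q a c α j n x
    rw [bCoeff_reverse h α (n := n + 1) (m := m + 1) (by omega),
      uCoeff_reverse h α (n := n + 1) (m := m + 2) (by omega)] at e3
    rw [uProd_succ, eval_R_succ_succ]
    rw [uProd_succ] at e2 ⊢
    linear_combination (x - bCoeff q a c (1 - α) j (m + 1)) * e2
      - uCoeff q a c (1 - α) j (m + 1) * e1
      + uProd q a c (1 - α) j m * uCoeff q a c (1 - α) j (m + 1) * e3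

end Reversal

/-! ### Christoffel–Darboux formulas -/

section ChristoffelDarboux

variable {q a c α : ℝ} {j : ℕ}

theorem christoffel_darboux {n : ℕ} (hu : ∀ k ≤ n, uProd q a c α j k ≠ 0) (x y : ℝ) :
    (R q a c α j (n + 1)).eval x * (R q a c α j n).eval y
        - (R q a c α j n).eval x * (R q a c α j (n + 1)).eval y
      = (x - y) * (uProd q a c α j n * ∑ k ∈ Finset.range (n + 1),
          (R q a c α j k).eval x * (R q a c α j k).eval y / uProd q a c α j k) := by
  induction n with
  | zero => simp [uProd_zero, R]
  | succ n ih =>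
    have h1 := hu (n + 1) le_rfl
    rw [Finset.sum_range_succ, mul_add, mul_div_cancel₀ _ h1, uProd_succ, eval_R_succ_succ,
      eval_R_succ_succ]
    linear_combination uCoeff q a c α j (n + 1) * ih fun k hk => hu k (by omega)

theorem christoffel_darboux_derivative {n : ℕ} (hu : ∀ k ≤ n, uProd q a c α j k ≠ 0) (x : ℝ) :
    (derivative (R q a c α j (n + 1))).eval x * (R q a c α j n).eval x
        - (derivative (R q a c α j n)).eval x * (R q a c α j (n + 1)).eval x
      = uProd q a c α j n * ∑ k ∈ Finset.range (n + 1),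
          (R q a c α j k).eval x * (R q a c α j k).eval x / uProd q a c α j k := by
  induction n with
  | zero => simp [uProd_zero, R]
  | succ n ih =>
    have h1 := hu (n + 1) le_rfl
    have hd : (derivative (R q a c α j (n + 2))).eval x
        = (R q a c α j (n + 1)).eval x
          + (x - bCoeff q a c α j (n + 1)) * (derivative (R q a c α j (n + 1))).eval x
          - uCoeff q a c α j (n + 1) * (derivative (R q a c α j n)).eval x := by
      rw [R_succ_succ]
      simp
    rw [Finset.sum_range_succ, mul_add, mul_div_cancel₀ _ h1, uProd_succ, eval_R_succ_succ, hd]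
    linear_combination uCoeff q a c α j (n + 1) * ih fun k hk => hu k (by omega)

end ChristoffelDarboux

/-! ### Positivity of the coefficients `u_n` -/

section Positivity

variable {j : ℕ} {q a c : ℝ}

theorem uCoeff_pos_of_le (h : Admissible j q a c) (α : ℝ) {n : ℕ} (h1 : 1 ≤ n) (h2 : n ≤ j) :
    0 < uCoeff q a c α j n := by
  have hq := h.q_pos
  have ha := h.a_ne
  have hc := h.c_ne
  have hm := h.mul_pos
  have hX : 0 < q ^ n := by positivity
  rw [uCoeff, if_neg (by omega)]
  have t1 : q ^ n - 1 < 0 := by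
    have := h.pow_lt_pow (show 0 < n by omega)
    rw [pow_zero] at this
    linarith
  have t2 : 0 < q ^ n - q ^ (2 * j + 2) := sub_pos.2 (h.pow_lt_pow (by omega))
  -- Up to positive factors this is `(a c q^m - 1)(1 - a c q^l)` with `m + l = 2 j`; both `1 - a c
  -- q^i` have the same sign, so the product is negative.
  have t3 : (a * c * q ^ n - q) * (q ^ n - a * c * q ^ (2 * j + 1)) < 0 := by
    obtain ⟨m, rfl⟩ := Nat.exists_eq_add_of_le' h1
    obtain ⟨l, hl⟩ := Nat.exists_eq_add_of_le (show m + 1 ≤ 2 * j + 1 by omega)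
    have e1 : a * c * q ^ (m + 1) - q = q * (a * c * q ^ m - 1) := by ring
    have e2 : q ^ (m + 1) - a * c * q ^ (2 * j + 1) = q ^ (m + 1) * (1 - a * c * q ^ l) := by
      rw [hl]
      ring
    rw [e1, e2]
    rcases h.mul_sign with hs | hs
    · have u1 := sub_neg.2 (hs m)
      have u2 := sub_pos.2 (hs l)
      exact mul_neg_of_neg_of_pos (mul_neg_of_pos_of_neg hq u1) (by positivity)
    · have u1 := sub_pos.2 (hs m (by omega))
      have u2 := sub_neg.2 (hs l (by omega))
      exact mul_neg_of_pos_of_neg (by positivity) (mul_neg_of_pos_of_neg hX u2)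
  -- Both bounds `q < a / c < q⁻¹` are used here, one for each factor, with `q^j ≤ q^n`.
  have t4 : 0 < (a * q ^ n - c * q ^ (j + 1)) * (c * q ^ n - a * q ^ (j + 1)) := by
    have e : (a * q ^ n - c * q ^ (j + 1)) * (c * q ^ n - a * q ^ (j + 1))
        = c ^ 2 * (a / c * q ^ n - q ^ (j + 1)) * (q ^ n - a / c * q ^ (j + 1)) := by
      field_simp
    have hl := h.lower
    have hr := h.ratio_mul_lt
    have hJ : 0 < q ^ j := by positivity
    have u0 : q ^ j ≤ q ^ n := h.pow_le_pow h2
    have u1 : 0 < a / c * q ^ n - q ^ (j + 1) := by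
      rw [pow_succ]
      nlinarith
    have u2 : 0 < q ^ n - a / c * q ^ (j + 1) := by
      have : a / c * q ^ (j + 1) = a / c * q * q ^ j := by ring
      rw [this]
      nlinarith
    rw [e]
    positivity
  have t5 : 0 < q ^ (2 * n) - q ^ (2 * j + 1) := sub_pos.2 (h.pow_lt_pow (by omega))
  have t6 : 0 < q ^ (2 * n) - q ^ (2 * j + 3) := sub_pos.2 (h.pow_lt_pow (by omega))
  refine div_pos ?_ (by positivity)
  have e : (q ^ n - 1) * (q ^ n - q ^ (2 * j + 2)) * (a * c * q ^ n - q)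
        * (q ^ n - a * c * q ^ (2 * j + 1)) * (a * q ^ n - c * q ^ (j + 1))
        * (c * q ^ n - a * q ^ (j + 1))
      = -(q ^ n - 1) * (q ^ n - q ^ (2 * j + 2))
        * -((a * c * q ^ n - q) * (q ^ n - a * c * q ^ (2 * j + 1)))
        * ((a * q ^ n - c * q ^ (j + 1)) * (c * q ^ n - a * q ^ (j + 1))) := by ring
  rw [e]
  have := neg_pos.2 t1
  have := neg_pos.2 t3
  positivity

theorem uCoeff_pos (h : Admissible j q a c) {α : ℝ} (h0 : 0 < α) (h1 : α < 1) {n : ℕ}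
    (hn : 1 ≤ n) (hn' : n ≤ 2 * j + 1) : 0 < uCoeff q a c α j n := by
  rcases lt_trichotomy n (j + 1) with h2 | rfl | h2
  · exact uCoeff_pos_of_le h α hn (by omega)
  · rw [uCoeff_mid]
    have := h.bJump_ne
    have := sub_pos.2 h1
    positivity
  · rw [uCoeff_reverse h α (m := 2 * j + 2 - n) (by omega)]
    exact uCoeff_pos_of_le h _ (by omega) (by omega)

theorem uProd_pos (h : Admissible j q a c) {α : ℝ} (h0 : 0 < α) (h1 : α < 1) {n : ℕ}
    (hn : n ≤ 2 * j + 1) : 0 < uProd q a c α j n :=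
  Finset.prod_pos fun k hk => by
    rw [Finset.mem_Icc] at hk
    exact uCoeff_pos h h0 h1 hk.1 (by omega)

theorem uProd_zero_pos (h : Admissible j q a c) : 0 < uProd q a c 0 j j :=
  Finset.prod_pos fun k hk => by
    rw [Finset.mem_Icc] at hk
    exact uCoeff_pos_of_le h 0 hk.1 hk.2

end Positivity

/-! ### Distinctness of the lattice points -/

section Lattice

variable {j : ℕ} {q a c : ℝ}

theorem lattice_sub_even (h : Admissible j q a c) (s t : ℕ) :
    lattice q a c (2 * s) - lattice q a c (2 * t)
      = (a * q ^ s - a * q ^ t) * (a ^ 2 * q ^ (s + t) - 1) / (2 * a ^ 2 * q ^ (s + t)) := by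
  have ha := h.a_ne
  have h1 := pow_ne_zero s h.q_ne
  have h2 := pow_ne_zero t h.q_ne
  rw [lattice_even, lattice_even, pow_add]
  field_simp
  ring

theorem lattice_sub_odd (h : Admissible j q a c) (s t : ℕ) :
    lattice q a c (2 * s) - lattice q a c (2 * t + 1)
      = (a * q ^ s - c * q ^ t) * (a * c * q ^ (s + t) - 1) / (2 * (a * c) * q ^ (s + t)) := by
  have ha := h.a_ne
  have hc := h.c_ne
  have h1 := pow_ne_zero s h.q_ne
  have h2 := pow_ne_zero t h.q_ne
  rw [lattice_even, lattice_odd, pow_add]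
  field_simp
  ring

theorem lattice_even_ne (h : Admissible j q a c) {s t : ℕ} (hs : s ≤ j) (ht : t ≤ j)
    (hst : s ≠ t) : lattice q a c (2 * s) ≠ lattice q a c (2 * t) := by
  rw [← sub_ne_zero, lattice_sub_even h]
  have ha := h.a_ne
  have h1 := pow_ne_zero (s + t) h.q_ne
  refine div_ne_zero (mul_ne_zero ?_ (sub_ne_zero.2 (h.sq_mul_pow_ne_one (by omega) (by omega))))
    (by simp [ha, h1])
  rw [← mul_sub]
  exact mul_ne_zero ha (sub_ne_zero.2 (h.pow_ne_pow hst))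

theorem lattice_even_ne_odd (h : Admissible j q a c) {s t : ℕ} (hs : s ≤ j) (ht : t ≤ j) :
    lattice q a c (2 * s) ≠ lattice q a c (2 * t + 1) := by
  rw [← sub_ne_zero, lattice_sub_odd h]
  have ha := h.a_ne
  have hc := h.c_ne
  have h1 := pow_ne_zero (s + t) h.q_ne
  exact div_ne_zero (mul_ne_zero (sub_ne_zero.2 (h.mul_pow_ne_mul_pow _ _))
    (sub_ne_zero.2 (h.mul_pow_ne_one (by omega)))) (by simp [ha, hc, h1])

theorem lattice_injOn (h : Admissible j q a c) :
    Set.InjOn (lattice q a c) (Set.Iic (2 * j + 1)) := by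
  intro m hm n hn e
  rw [Set.mem_Iic] at hm hn
  by_contra hne
  obtain ⟨s, rfl | rfl⟩ := Nat.even_or_odd' m <;> obtain ⟨t, rfl | rfl⟩ := Nat.even_or_odd' n
  · exact lattice_even_ne h (by omega) (by omega) (by omega) e
  · exact lattice_even_ne_odd h (by omega) (by omega) e
  · exact lattice_even_ne_odd h (by omega) (by omega) e.symm
  · rw [lattice_odd_eq_swap, lattice_odd_eq_swap] at e
    exact lattice_even_ne h.symm (by omega) (by omega) (by omega) e

theorem prod_range_two_mul {M : Type*} [CommMonoid M] (f : ℕ → M) (n : ℕ) :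
    ∏ i ∈ Finset.range (2 * n), f i
      = (∏ s ∈ Finset.range n, f (2 * s)) * ∏ s ∈ Finset.range n, f (2 * s + 1) := by
  induction n with
  | zero => simp
  | succ n ih =>
    rw [show 2 * (n + 1) = 2 * n + 1 + 1 by ring, Finset.prod_range_succ, Finset.prod_range_succ,
      ih, Finset.prod_range_succ, Finset.prod_range_succ]
    simp only [mul_assoc, mul_left_comm, mul_comm]

theorem sum_range_two_mul {M : Type*} [AddCommMonoid M] (f : ℕ → M) (n : ℕ) :
    ∑ i ∈ Finset.range (2 * n), f i
      = ∑ s ∈ Finset.range n, f (2 * s) + ∑ s ∈ Finset.range n, f (2 * s + 1) :=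
  prod_range_two_mul (M := Multiplicative M) f n

theorem R_last_eq_prod (h : Admissible j q a c) (α : ℝ) :
    R q a c α j (2 * j + 2)
      = ∏ i ∈ Finset.range (2 * j + 2), (X - C (lattice q a c i)) := by
  rw [R_last h, show 2 * j + 2 = 2 * (j + 1) by ring, prod_range_two_mul, evenPoly, evenPoly]
  simp only [lattice_odd_eq_swap]

theorem eval_R_last (h : Admissible j q a c) (α : ℝ) {i : ℕ} (hi : i ≤ 2 * j + 1) :
    (R q a c α j (2 * j + 2)).eval (lattice q a c i) = 0 := by
  rw [R_last_eq_prod h, eval_prod]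
  exact Finset.prod_eq_zero (Finset.mem_range.2 (show i < 2 * j + 2 by omega)) (by simp)

end Lattice

/-! ### Weights as Christoffel numbers -/

section Orthogonality

variable {j : ℕ} {q a c α : ℝ}

/-- The confluent Christoffel–Darboux formula at a zero of `R_{N+1}`: the weight is the reciprocal
of the positive kernel on the diagonal. -/
theorem weight_inv (h : Admissible j q a c) (h0 : 0 < α) (h1 : α < 1) {i : ℕ}
    (hi : i ≤ 2 * j + 1) :
    (R q a c α j (2 * j + 1)).eval (lattice q a c i)
        * (derivative (R q a c α j (2 * j + 2))).eval (lattice q a c i)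
      = uProd q a c α j (2 * j + 1) * ∑ k ∈ Finset.range (2 * j + 2),
        (R q a c α j k).eval (lattice q a c i) * (R q a c α j k).eval (lattice q a c i)
          / uProd q a c α j k := by
  have := christoffel_darboux_derivative (fun k hk => (uProd_pos h h0 h1 hk).ne')
    (lattice q a c i) (n := 2 * j + 1)
  rw [← this, eval_R_last h α hi]
  ring

theorem kernel_pos (h : Admissible j q a c) (h0 : 0 < α) (h1 : α < 1) (x : ℝ) :
    0 < ∑ k ∈ Finset.range (2 * j + 2),
        (R q a c α j k).eval x * (R q a c α j k).eval x / uProd q a c α j k := by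
  refine Finset.sum_pos' (fun k hk => ?_) ⟨0, by simp, ?_⟩
  · rw [Finset.mem_range] at hk
    exact div_nonneg (mul_self_nonneg _) (uProd_pos h h0 h1 (by omega)).le
  · rw [eval_R_zero, uProd_zero]
    norm_num

theorem weight_denom_pos (h : Admissible j q a c) (h0 : 0 < α) (h1 : α < 1) {i : ℕ}
    (hi : i ≤ 2 * j + 1) :
    0 < (R q a c α j (2 * j + 1)).eval (lattice q a c i)
        * (derivative (R q a c α j (2 * j + 2))).eval (lattice q a c i) := by
  rw [weight_inv h h0 h1 hi]
  exact mul_pos (uProd_pos h h0 h1 le_rfl) (kernel_pos h h0 h1 _)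

theorem weight_pos (h : Admissible j q a c) (h0 : 0 < α) (h1 : α < 1) {i : ℕ}
    (hi : i ≤ 2 * j + 1) : 0 < weight q a c α j i :=
  div_pos (uProd_pos h h0 h1 le_rfl) (weight_denom_pos h h0 h1 hi)

/-- Dual orthogonality: off the diagonal, the kernel vanishes at two distinct zeros of `R_{N+1}`. -/
theorem kernel_mul_weight (h : Admissible j q a c) (h0 : 0 < α) (h1 : α < 1) {i l : ℕ}
    (hi : i ≤ 2 * j + 1) (hl : l ≤ 2 * j + 1) :
    (∑ k ∈ Finset.range (2 * j + 2),
        (R q a c α j k).eval (lattice q a c i) * (R q a c α j k).eval (lattice q a c l)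
          / uProd q a c α j k) * weight q a c α j l = if i = l then 1 else 0 := by
  split_ifs with hil
  · subst hil
    have hu := (uProd_pos h h0 h1 (n := 2 * j + 1) le_rfl).ne'
    have hk := (kernel_pos h h0 h1 (lattice q a c i)).ne'
    rw [weight, weight_inv h h0 h1 hi, ← div_div, div_self hu, mul_one_div_cancel hk]
  · have := christoffel_darboux (fun k hk => (uProd_pos h h0 h1 hk).ne')
      (lattice q a c i) (lattice q a c l) (n := 2 * j + 1)
    rw [eval_R_last h α hi, eval_R_last h α hl, zero_mul, mul_zero, sub_zero] at this
    have hne : lattice q a c i - lattice q a c l ≠ 0 :=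
      sub_ne_zero.2 fun e => hil (lattice_injOn h hi hl e)
    have hu := (uProd_pos h h0 h1 (n := 2 * j + 1) le_rfl).ne'
    rw [((mul_eq_zero.1 ((mul_eq_zero.1 this.symm).resolve_left hne)).resolve_left hu), zero_mul]

theorem orthogonality (h : Admissible j q a c) (h0 : 0 < α) (h1 : α < 1) {n m : ℕ}
    (hn : n ≤ 2 * j + 1) (hm : m ≤ 2 * j + 1) :
    ∑ i ∈ Finset.range (2 * j + 2), weight q a c α j i
          * (R q a c α j n).eval (lattice q a c i) * (R q a c α j m).eval (lattice q a c i)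
        = if n = m then uProd q a c α j n else 0 := by
  let V : Matrix (Fin (2 * j + 2)) (Fin (2 * j + 2)) ℝ := Matrix.of fun i k =>
    (R q a c α j k).eval (lattice q a c i) / uProd q a c α j k
  let W : Matrix (Fin (2 * j + 2)) (Fin (2 * j + 2)) ℝ := Matrix.of fun k i =>
    (R q a c α j k).eval (lattice q a c i) * weight q a c α j i
  have hVW : V * W = 1 := by
    ext i l
    rw [Matrix.mul_apply, Matrix.one_apply]
    have := kernel_mul_weight h h0 h1 (i := i) (l := l) (by omega) (by omega)
    rw [← Fin.sum_univ_eq_sum_range (fun k => (R q a c α j k).eval (lattice q a c i)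
      * (R q a c α j k).eval (lattice q a c l) / uProd q a c α j k), Finset.sum_mul] at this
    simp only [Fin.ext_iff]
    rw [← this]
    refine Finset.sum_congr rfl fun k _ => ?_
    simp only [V, W, Matrix.of_apply]
    ring
  -- For square matrices a right inverse is a left inverse; this turns orthogonality over degrees
  -- into orthogonality over lattice points.
  have hWV' : W * V = 1 := mul_eq_one_comm.1 hVW
  have hWV := congrFun (congrFun hWV' ⟨n, by omega⟩) ⟨m, by omega⟩
  rw [Matrix.mul_apply, Matrix.one_apply] at hWV
  have hu := (uProd_pos h h0 h1 hm).ne'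
  rw [← Fin.sum_univ_eq_sum_range (fun i => weight q a c α j i
    * (R q a c α j n).eval (lattice q a c i) * (R q a c α j m).eval (lattice q a c i))]
  have e : ∀ i : Fin (2 * j + 2), weight q a c α j i
      * (R q a c α j n).eval (lattice q a c i) * (R q a c α j m).eval (lattice q a c i)
      = W ⟨n, by omega⟩ i * V i ⟨m, by omega⟩ * uProd q a c α j m := by
    intro i
    simp only [V, W, Matrix.of_apply]
    field_simp
  rw [Finset.sum_congr rfl fun i _ => e i, ← Finset.sum_mul, hWV]
  simp only [Fin.mk.injEq]
  split_ifs with hnm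
  · rw [hnm, one_mul]
  · rw [zero_mul]

end Orthogonality

/-! ### The constant `K_N` -/

section Normalization

variable {j : ℕ} {q a c : ℝ}

theorem uProd_eq_prod_range (q a c α : ℝ) (j n : ℕ) :
    uProd q a c α j n = ∏ k ∈ Finset.range n, uCoeff q a c α j (k + 1) := by
  induction n with
  | zero => simp [uProd_zero]
  | succ n ih => rw [uProd_succ, ih, Finset.prod_range_succ]

/-- The match is factor by factor: the `k`-th factors of the Pochhammer quotient multiply to `4
u_{k+1}`, and the prefactor is that of `bJump`. The choice `α = 0` is immaterial, as `u_1, …, u_j`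
do not involve `α`. -/
theorem KN_eq (h : Admissible j q a c) :
    KN q a c j = -(bJump q a c j * uProd q a c 0 j j) / 2 := by
  have hq := h.q_pos
  have ha := h.a_ne
  have hc := h.c_ne
  have hJ : q ^ j ≠ 0 := (pow_pos hq j).ne'
  have z1 : q ^ (-2 * (j : ℤ) - 1) = (q * (q ^ j) ^ 2)⁻¹ := by
    rw [show q * (q ^ j) ^ 2 = q ^ (2 * j + 1) by ring, ← zpow_neg_eq]
    congr 1
    push_cast
    ring
  have z2 : q ^ (-2 * (j : ℤ)) = ((q ^ j) ^ 2)⁻¹ := by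
    rw [show (q ^ j) ^ 2 = q ^ (2 * j) by ring, ← zpow_neg_eq]
    congr 1
  have z3 : q ^ (1 - 2 * (j : ℤ)) = q * ((q ^ j) ^ 2)⁻¹ := by
    rw [show 1 - 2 * (j : ℤ) = 1 + (-2 * (j : ℤ)) by ring, zpow_add₀ hq.ne', zpow_one, z2]
  rw [KN, bJump, uProd_eq_prod_range]
  simp only [zpow_neg_eq, z1, z2, z3, qPoch]
  have term : ∀ k ∈ Finset.range j,
      (1 - (q ^ j)⁻¹ * q ^ k) ^ 2 * (1 - (q * (q ^ j) ^ 2)⁻¹ * q ^ k) * (1 - q * q ^ k)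
        * (1 - a * c * q ^ k) * (1 - a * (q ^ j)⁻¹ / c * q ^ k) * (1 - c * (q ^ j)⁻¹ / a * q ^ k)
        * (1 - ((q ^ j) ^ 2)⁻¹ / (a * c) * q ^ k)
      = 4 * uCoeff q a c 0 j (k + 1) * ((1 - (q * (q ^ j) ^ 2)⁻¹ * (q ^ 2) ^ k)
        * (1 - ((q ^ j) ^ 2)⁻¹ * (q ^ 2) ^ k) ^ 2 * (1 - q * ((q ^ j) ^ 2)⁻¹ * (q ^ 2) ^ k)) ∧
      (1 - (q * (q ^ j) ^ 2)⁻¹ * (q ^ 2) ^ k)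
        * (1 - ((q ^ j) ^ 2)⁻¹ * (q ^ 2) ^ k) ^ 2 * (1 - q * ((q ^ j) ^ 2)⁻¹ * (q ^ 2) ^ k)
        ≠ 0 := by
    intro k hk
    rw [Finset.mem_range] at hk
    have n1 : q * (q ^ j) ^ 2 - (q ^ k) ^ 2 ≠ 0 := by
      have := sub_ne_zero.2 (h.pow_ne_pow (show 2 * j + 1 ≠ 2 * k by omega))
      convert this using 1
      ring
    have n2 : (q ^ j) ^ 2 - q * (q ^ k) ^ 2 ≠ 0 := by
      have := sub_ne_zero.2 (h.pow_ne_pow (show 2 * j ≠ 2 * k + 1 by omega))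
      convert this using 1
      ring
    have n3 : q ^ j - q ^ k ≠ 0 := sub_ne_zero.2 (h.pow_ne_pow hk.ne')
    have n4 : q ^ j + q ^ k ≠ 0 := by positivity
    have f1 : q ^ (2 * (k + 1)) - q ^ (2 * j + 1) = -(q * ((q ^ j) ^ 2 - q * (q ^ k) ^ 2)) := by
      ring
    have f2 : q ^ (2 * (k + 1)) - q ^ (2 * j + 3)
        = -(q ^ 2 * (q * (q ^ j) ^ 2 - (q ^ k) ^ 2)) := by ring
    have f3 : q ^ (j + 1) + q ^ (k + 1) = q * (q ^ j + q ^ k) := by ring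
    have f6 : q ^ (2 * j + 1) = q * (q ^ j) ^ 2 := by ring
    have f7 : q ^ (2 * j + 2) = q ^ 2 * (q ^ j) ^ 2 := by ring
    have g1 : 1 - (q * (q ^ j) ^ 2)⁻¹ * (q ^ 2) ^ k
        = (q * (q ^ j) ^ 2 - (q ^ k) ^ 2) / (q * (q ^ j) ^ 2) := by
      field_simp
      ring
    have g2 : 1 - ((q ^ j) ^ 2)⁻¹ * (q ^ 2) ^ k
        = (q ^ j - q ^ k) * (q ^ j + q ^ k) / (q ^ j) ^ 2 := by
      field_simp
      ring
    have g3 : 1 - q * ((q ^ j) ^ 2)⁻¹ * (q ^ 2) ^ k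
        = ((q ^ j) ^ 2 - q * (q ^ k) ^ 2) / (q ^ j) ^ 2 := by
      field_simp
      ring
    have g4 : 1 - (q ^ j)⁻¹ * q ^ k = (q ^ j - q ^ k) / q ^ j := by field_simp
    rw [g1, g2, g3, g4]
    constructor
    · rw [uCoeff, if_neg (by omega), f1, f2, f3, f6, f7, pow_succ' q k, pow_succ' q j]
      generalize q ^ j = J at *
      generalize q ^ k = X at *
      generalize q * J ^ 2 - X ^ 2 = S at *
      generalize J + X = T at *
      generalize J ^ 2 - q * X ^ 2 = V at *
      generalize J - X = W at *
      field_simp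
      ring
    · simp [n1, n2, n3, n4, hJ, hq.ne']
  have hnum := Finset.prod_congr rfl fun k hk => (term k hk).1
  have hden := Finset.prod_ne_zero_iff.2 fun k hk => (term k hk).2
  simp only [Finset.prod_mul_distrib, Finset.prod_pow, Finset.prod_const, Finset.card_range]
    at hnum hden
  have h1 := sub_ne_zero.2 h.q_lt_one.ne
  have p : (2 : ℝ) ^ (2 * j + 2) = 4 * 4 ^ j := by
    rw [pow_add, pow_mul]
    norm_num
    ring
  have shape : ∀ P N₁ N₂ N₃ N₄ N₅ N₆ N₇ E D₁ D₂ D₃ : ℝ,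
      P * N₁ ^ 2 * N₂ * N₃ * N₄ * N₅ * N₆ * N₇ / (E * D₁ * D₂ ^ 2 * D₃)
      = P * (N₁ ^ 2 * N₂ * N₃ * N₄ * N₅ * N₆ * N₇) / (E * (D₁ * D₂ ^ 2 * D₃)) := by
    intros
    congr 1 <;> ring
  rw [shape, hnum, p]
  clear hnum term shape
  generalize ∏ x ∈ Finset.range j, uCoeff q a c 0 j (x + 1) = U
  revert hden
  generalize (∏ x ∈ Finset.range j, (1 - (q * (q ^ j) ^ 2)⁻¹ * (q ^ 2) ^ x))
    * (∏ x ∈ Finset.range j, (1 - ((q ^ j) ^ 2)⁻¹ * (q ^ 2) ^ x)) ^ 2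
    * ∏ x ∈ Finset.range j, (1 - q * ((q ^ j) ^ 2)⁻¹ * (q ^ 2) ^ x) = D
  intro hden
  generalize q ^ (j + 1) = J' at *
  generalize q ^ j = J at *
  generalize q - 1 = p' at *
  field_simp
  ring

theorem KN_swap (h : Admissible j q a c) : KN q c a j = -KN q a c j := by
  rw [KN_eq h, KN_eq h.symm, bJump, bJump]
  have : uProd q c a 0 j j = uProd q a c 0 j j := by
    rw [uProd_congr q a c 0 (1 - 0) le_rfl]
    exact Finset.prod_congr rfl fun k _ => uCoeff_swap q a c 0 j k
  rw [this, mul_comm c a, mul_right_comm 2 c a]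
  ring

theorem KN_ne (h : Admissible j q a c) : KN q a c j ≠ 0 := by
  rw [KN_eq h]
  have := h.bJump_ne
  have := (uProd_zero_pos h).ne'
  simp_all

theorem uProd_last_eq_KN (h : Admissible j q a c) (α : ℝ) :
    uProd q a c α j (2 * j + 1) = 4 * α * (1 - α) * KN q a c j ^ 2 := by
  rw [uProd_last h, KN_eq h]
  ring

/-- The sign comes from `bJump`, where `1 - a c q^j` has the sign of `1 - a c`; the product `u_1 ⋯
u_j` is positive. -/
theorem sign_KN (h : Admissible j q a c) :
    Real.sign ((c - a) * (1 - a * c)) = Real.sign (KN q a c j) := by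
  obtain ⟨P, hP, e⟩ : ∃ P > 0, KN q a c j = (c - a) * (1 - a * c) * P := by
    have hq := h.q_pos
    have hm := h.mul_pos
    have hU := uProd_zero_pos h
    have h1 : 0 < 1 - q := sub_pos.2 h.q_lt_one
    have h2 : 0 < 1 - q ^ (j + 1) := by
      have := h.pow_lt_pow (Nat.succ_pos j)
      rw [pow_zero] at this
      exact sub_pos.2 this
    have h3 : 0 < (1 - a * c * q ^ j) / (1 - a * c) := by
      rcases h.mul_sign with hs | hs
      · have := hs 0
        rw [pow_zero, mul_one] at this
        exact div_pos (sub_pos.2 (hs j)) (sub_pos.2 this)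
      · have := hs 0 (by omega)
        rw [pow_zero, mul_one] at this
        exact div_pos_of_neg_of_neg (sub_neg.2 (hs j (by omega))) (sub_neg.2 this)
    have h4 : 1 - a * c ≠ 0 := by
      have := h.mul_pow_ne_one (Nat.zero_le (2 * j))
      rw [pow_zero, mul_one] at this
      exact sub_ne_zero.2 this.symm
    refine ⟨(1 - a * c * q ^ j) / (1 - a * c) * (1 - q ^ (j + 1)) * (q ^ j)⁻¹
      * uProd q a c 0 j j / (4 * (a * c) * (1 - q)), by positivity, ?_⟩
    have h5 : q - 1 = -(1 - q) := by ring
    rw [KN_eq h, bJump, zpow_neg_eq, h5]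
    have ha := h.a_ne
    have hc := h.c_ne
    generalize uProd q a c 0 j j = U at *
    generalize q ^ (j + 1) = J' at *
    have hJ := (pow_pos hq j).ne'
    generalize q ^ j = J at *
    have h6 := h1.ne'
    generalize 1 - q = p at *
    clear h3
    generalize 1 - a * c = g at *
    field_simp
    ring
  rw [e]
  rcases lt_trichotomy ((c - a) * (1 - a * c)) 0 with hv | hv | hv
  · rw [Real.sign_of_neg hv, Real.sign_of_neg (mul_neg_of_neg_of_pos hv hP)]
  · rw [hv, zero_mul]
  · rw [Real.sign_of_pos hv, Real.sign_of_pos (mul_pos hv hP)]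

theorem KN_eq_sign_mul_sqrt (h : Admissible j q a c) :
    KN q a c j
      = Real.sign ((c - a) * (1 - a * c)) * Real.sqrt (uProd q a c (1 / 2) j (2 * j + 1)) := by
  have e : uProd q a c (1 / 2) j (2 * j + 1) = KN q a c j ^ 2 := by
    rw [uProd_last_eq_KN h]
    ring
  rw [sign_KN h, e, Real.sqrt_sq_eq_abs]
  rcases (KN_ne h).lt_or_gt with h1 | h1
  · rw [Real.sign_of_neg h1, abs_of_neg h1]
    ring
  · rw [Real.sign_of_pos h1, abs_of_pos h1, one_mul]

end Normalization

/-! ### Values of `R_N` on the lattice, and the weights -/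

section Values

variable {j : ℕ} {q a c : ℝ}

theorem evenPoly_eval_even (q a c : ℝ) {j s : ℕ} (hs : s ≤ j) :
    (evenPoly q a c j).eval (lattice q a c (2 * s)) = 0 := by
  rw [evenPoly, eval_prod]
  exact Finset.prod_eq_zero (Finset.mem_range.2 (show s < j + 1 by omega)) (by simp)

theorem evenPoly_swap_eval (q a c : ℝ) (j : ℕ) (x : ℝ) :
    (evenPoly q c a j).eval x = ∏ t ∈ Finset.range (j + 1), (x - lattice q a c (2 * t + 1)) := by
  rw [evenPoly, eval_prod]
  simp [lattice_odd_eq_swap]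

theorem evenPoly_swap_eval_even_ne (h : Admissible j q a c) {s : ℕ} (hs : s ≤ j) :
    (evenPoly q c a j).eval (lattice q a c (2 * s)) ≠ 0 := by
  rw [evenPoly_swap_eval]
  refine Finset.prod_ne_zero_iff.2 fun t ht => sub_ne_zero.2 (lattice_even_ne_odd h hs ?_)
  rw [Finset.mem_range] at ht
  omega

/-- Run the recurrence down to the middle (`n = j`, `m = j + 1`). At an even point `E` vanishes, so
both middle polynomials are multiples of the nonzero value of `O`, which cancels. -/
theorem eval_R_even (h : Admissible j q a c) {α : ℝ} (h1 : α < 1) {s : ℕ} (hs : s ≤ j) :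
    (R q a c α j (2 * j + 1)).eval (lattice q a c (2 * s)) = 2 * α * KN q a c j := by
  have e := eval_R_mul_uProd h α (eval_R_last h α (i := 2 * s) (by omega)) (n := j) (m := j + 1)
    (by omega)
  have e1 := congrArg (eval (lattice q a c (2 * s))) (bJump_mul_R h α)
  have hP := evenPoly_swap_eval_even_ne h hs
  have hA := evenPoly_eval_even q a c hs
  rw [R_mid_succ_eq h, uProd_succ, uCoeff_mid, uProd_congr q a c (1 - α) 0 le_rfl] at e
  simp only [eval_add, eval_mul, eval_C, eval_sub, hA, mul_zero, zero_add, zero_sub] at e e1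
  have hδ := h.bJump_ne
  have hα : 1 - α ≠ 0 := (sub_pos.2 h1).ne'
  rw [KN_eq h]
  apply mul_right_cancel₀ (mul_ne_zero (mul_ne_zero hα hδ) hP)
  linear_combination -bJump q a c j * e
    + bJump q a c j ^ 2 * uProd q a c 0 j j * α * (1 - α) * e1

theorem eval_R_odd (h : Admissible j q a c) {α : ℝ} (h0 : 0 < α) {s : ℕ} (hs : s ≤ j) :
    (R q a c α j (2 * j + 1)).eval (lattice q a c (2 * s + 1))
      = -(2 * (1 - α) * KN q a c j) := by
  have := eval_R_even h.symm (α := 1 - α) (by linarith) hs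
  rw [R_swap h, sub_sub_cancel, KN_swap h] at this
  rw [lattice_odd_eq_swap, this]
  ring

theorem weight_swap (h : Admissible j q a c) (α : ℝ) (s : ℕ) :
    weight q a c α j (2 * s + 1) = weight q c a (1 - α) j (2 * s) := by
  have : uProd q c a (1 - α) j (2 * j + 1) = uProd q a c α j (2 * j + 1) :=
    Finset.prod_congr rfl fun k _ => by rw [uCoeff_swap, sub_sub_cancel]
  rw [weight, weight, R_swap h, R_swap h, sub_sub_cancel, this, lattice_odd_eq_swap]

theorem weight_even (h : Admissible j q a c) {α : ℝ} (h0 : 0 < α) (h1 : α < 1) {s : ℕ}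
    (hs : s ≤ j) :
    weight q a c α j (2 * s) = 2 * (1 - α) * KN q a c j
      / (derivative (R q a c 0 j (2 * j + 2))).eval (lattice q a c (2 * s)) := by
  have hd := (weight_denom_pos h h0 h1 (i := 2 * s) (by omega)).ne'
  rw [weight]
  rw [eval_R_even h h1 hs] at hd ⊢
  -- `R_{N+1}` does not depend on `α`, so its derivative may be taken at `α = 0`.
  rw [R_last h, ← R_last h 0] at hd ⊢
  have := right_ne_zero_of_mul hd
  have hK := KN_ne h
  rw [uProd_last_eq_KN h]
  field_simp
  ring

theorem weight_odd (h : Admissible j q a c) {α : ℝ} (h0 : 0 < α) (h1 : α < 1) {s : ℕ}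
    (hs : s ≤ j) :
    weight q a c α j (2 * s + 1) = -(2 * α * KN q a c j)
      / (derivative (R q a c 0 j (2 * j + 2))).eval (lattice q a c (2 * s + 1)) := by
  rw [weight_swap h, weight_even h.symm (by linarith) (by linarith) hs, KN_swap h,
    lattice_odd_eq_swap, R_swap h, R_last h, R_last h]
  congr 1
  ring

theorem weight_eq_mul_weight_half (h : Admissible j q a c) {α : ℝ} (h0 : 0 < α) (h1 : α < 1)
    {i : ℕ} (hi : i ≤ 2 * j + 1) :
    weight q a c α j i = (1 + (1 - 2 * α) * (-1) ^ i) * weight q a c (1 / 2) j i := by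
  obtain ⟨s, rfl | rfl⟩ := Nat.even_or_odd' i
  · rw [weight_even h h0 h1 (by omega), weight_even h (by norm_num) (by norm_num) (by omega),
      pow_mul]
    norm_num
    ring
  · rw [weight_odd h h0 h1 (by omega), weight_odd h (by norm_num) (by norm_num) (by omega),
      pow_succ, pow_mul]
    norm_num
    ring

theorem eval_R_half (h : Admissible j q a c) {i : ℕ} (hi : i ≤ 2 * j + 1) :
    (R q a c (1 / 2) j (2 * j + 1)).eval (lattice q a c i) = (-1) ^ i * KN q a c j := by
  obtain ⟨s, rfl | rfl⟩ := Nat.even_or_odd' i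
  · rw [eval_R_even h (by norm_num) (by omega), pow_mul]
    norm_num
  · rw [eval_R_odd h (by norm_num) (by omega), pow_succ, pow_mul]
    norm_num

/-- `R_N` is constant on each sublattice, so its orthogonality to `R_0` fixes the ratio of the two
total weights; their sum is `1`. -/
theorem sum_weight (h : Admissible j q a c) {α : ℝ} (h0 : 0 < α) (h1 : α < 1) :
    ∑ s ∈ Finset.range (j + 1), weight q a c α j (2 * s) = 1 - α ∧
    ∑ s ∈ Finset.range (j + 1), weight q a c α j (2 * s + 1) = α := by
  have e1 := orthogonality h h0 h1 (n := 0) (m := 0) (by omega) (by omega)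
  have e2 := orthogonality h h0 h1 (n := 2 * j + 1) (m := 0) (by omega) (by omega)
  rw [if_pos rfl, uProd_zero, show 2 * j + 2 = 2 * (j + 1) by ring, sum_range_two_mul] at e1
  rw [if_neg (by omega), show 2 * j + 2 = 2 * (j + 1) by ring, sum_range_two_mul] at e2
  simp only [eval_R_zero, mul_one] at e1 e2
  have e3 : ∑ s ∈ Finset.range (j + 1), weight q a c α j (2 * s)
      * (R q a c α j (2 * j + 1)).eval (lattice q a c (2 * s))
      = (∑ s ∈ Finset.range (j + 1), weight q a c α j (2 * s)) * (2 * α * KN q a c j) := by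
    rw [Finset.sum_mul]
    exact Finset.sum_congr rfl fun s hs => by
      rw [eval_R_even h h1 (by rw [Finset.mem_range] at hs; omega)]
  have e4 : ∑ s ∈ Finset.range (j + 1), weight q a c α j (2 * s + 1)
      * (R q a c α j (2 * j + 1)).eval (lattice q a c (2 * s + 1))
      = (∑ s ∈ Finset.range (j + 1), weight q a c α j (2 * s + 1))
        * -(2 * (1 - α) * KN q a c j) := by
    rw [Finset.sum_mul]
    exact Finset.sum_congr rfl fun s hs => by
      rw [eval_R_odd h h0 (by rw [Finset.mem_range] at hs; omega)]
  rw [e3, e4] at e2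
  have hK := KN_ne h
  have e5 : (∑ s ∈ Finset.range (j + 1), weight q a c α j (2 * s)) * α
      = (∑ s ∈ Finset.range (j + 1), weight q a c α j (2 * s + 1)) * (1 - α) := by
    apply mul_right_cancel₀ hK
    linear_combination e2 / 2
  constructor
  · linear_combination e5 + (1 - α) * e1
  · linear_combination -e5 + α * e1

end Values

/-! ### Identities for `q`-Pochhammer symbols -/

section ProductIdentities

variable {q : ℝ}

theorem qPoch_succ (z q : ℝ) (n : ℕ) : qPoch z q (n + 1) = qPoch z q n * (1 - z * q ^ n) :=
  Finset.prod_range_succ _ _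

theorem qPoch_succ' (z q : ℝ) (n : ℕ) : qPoch z q (n + 1) = (1 - z) * qPoch (z * q) q n := by
  rw [qPoch, Finset.prod_range_succ', mul_comm, qPoch]
  congr 1
  · simp
  · exact Finset.prod_congr rfl fun k _ => by ring

theorem qPoch_add (z q : ℝ) (m n : ℕ) :
    qPoch z q (m + n) = qPoch z q m * qPoch (z * q ^ m) q n := by
  rw [qPoch, Finset.prod_range_add, qPoch, qPoch]
  congr 1
  exact Finset.prod_congr rfl fun k _ => by ring

theorem prod_one_sub_pow_add (z q : ℝ) (s n : ℕ) :
    ∏ t ∈ Finset.range n, (1 - z * q ^ (s + t)) = qPoch (z * q ^ s) q n :=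
  Finset.prod_congr rfl fun t _ => by rw [pow_add, mul_assoc]

/-- Raising `s` by one slides the window of exponents `t - s` down by one, exchanging one end factor
for another. Inverting these factors gives the two symbols in `ρ⁻¹`; their signs cancel and the
powers of `q` collect. -/
theorem prod_one_sub_mul_qPoch (hq : q ≠ 0) {ρ : ℝ} (hρ : ρ ≠ 0) (j s : ℕ) :
    (∏ t ∈ Finset.range (j + 1), (1 - ρ * q ^ t / q ^ s)) * qPoch (ρ⁻¹ * (q ^ j)⁻¹) q s
        * q ^ ((j + 1) * s)
      = qPoch ρ q (j + 1) * qPoch (ρ⁻¹ * q) q s := by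
  induction s with
  | zero => simp [qPoch]
  | succ s ih =>
    have shift : (∏ t ∈ Finset.range (j + 1), (1 - ρ * q ^ t / q ^ (s + 1)))
          * (1 - ρ * q ^ j / q ^ s)
        = (∏ t ∈ Finset.range (j + 1), (1 - ρ * q ^ t / q ^ s)) * (1 - ρ / q ^ (s + 1)) := by
      rw [Finset.prod_range_succ', Finset.prod_range_succ _ j, pow_zero, mul_one]
      have : ∀ t, ρ * q ^ (t + 1) / q ^ (s + 1) = ρ * q ^ t / q ^ s := fun t => by
        field_simp
        ring
      simp only [this]
      ring
    have e1 : 1 - ρ⁻¹ * (q ^ j)⁻¹ * q ^ s = -(q ^ s / (ρ * q ^ j)) * (1 - ρ * q ^ j / q ^ s) := by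
      have := pow_ne_zero j hq
      have := pow_ne_zero s hq
      field_simp
      ring
    have e2 : 1 - ρ⁻¹ * q * q ^ s = -(q ^ (s + 1) / ρ) * (1 - ρ / q ^ (s + 1)) := by
      field_simp
      ring
    have e3 : q ^ ((j + 1) * (s + 1)) = q ^ ((j + 1) * s) * (q * q ^ j) := by ring
    have e4 : q ^ s / (ρ * q ^ j) * (q * q ^ j) = q ^ (s + 1) / ρ := by
      field_simp
      ring
    rw [qPoch_succ _ q s, qPoch_succ (ρ⁻¹ * q) q s, e1, e2, e3]
    linear_combination (-(q ^ (s + 1) / ρ) * (1 - ρ / q ^ (s + 1))) * ih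
      - (q ^ s / (ρ * q ^ j) * (q * q ^ j)) * qPoch (ρ⁻¹ * (q ^ j)⁻¹) q s * q ^ ((j + 1) * s)
        * shift
      - (∏ t ∈ Finset.range (j + 1), (1 - ρ * q ^ t / q ^ s)) * (1 - ρ / q ^ (s + 1))
        * qPoch (ρ⁻¹ * (q ^ j)⁻¹) q s * q ^ ((j + 1) * s) * e4

open Filter Topology in
-- The limit `ρ → 1` of the preceding identity, after cancelling `1 - ρ`: on the left it is the
-- factor `t = s`, on the right the first factor of `(ρ;q)_{j+1}`.
theorem prod_erase_one_sub_mul_qPoch (hq : q ≠ 0) {j s : ℕ} (hs : s ≤ j) :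
    (∏ t ∈ (Finset.range (j + 1)).erase s, (1 - q ^ t / q ^ s)) * qPoch (q ^ j)⁻¹ q s
        * q ^ ((j + 1) * s)
      = qPoch q q j * qPoch q q s := by
  let F : ℝ → ℝ := fun ρ => (∏ t ∈ (Finset.range (j + 1)).erase s, (1 - ρ * q ^ t / q ^ s))
    * qPoch (ρ⁻¹ * (q ^ j)⁻¹) q s * q ^ ((j + 1) * s)
  let G : ℝ → ℝ := fun ρ => qPoch (ρ * q) q j * qPoch (ρ⁻¹ * q) q s
  have hF : ContinuousAt F 1 := by
    unfold F qPoch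
    fun_prop (disch := norm_num)
  have hG : ContinuousAt G 1 := by
    unfold G qPoch
    fun_prop (disch := norm_num)
  have hFG : ∀ᶠ ρ in 𝓝[≠] (1 : ℝ), F ρ = G ρ := by
    filter_upwards [self_mem_nhdsWithin, nhdsWithin_le_nhds (eventually_ne_nhds one_ne_zero)]
      with ρ h1 h0
    have e := prod_one_sub_mul_qPoch hq h0 j s
    have hs' : s ∈ Finset.range (j + 1) := Finset.mem_range.2 (by omega)
    rw [← Finset.mul_prod_erase _ _ hs', qPoch_succ', mul_div_cancel_right₀ _ (pow_ne_zero s hq)]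
      at e
    have h2 : 1 - ρ ≠ 0 := sub_ne_zero.2 (Ne.symm h1)
    apply mul_left_cancel₀ h2
    simp only [F, G]
    linear_combination e
  have hlim := tendsto_nhds_unique_of_eventuallyEq (hF.tendsto.mono_left nhdsWithin_le_nhds)
    (hG.tendsto.mono_left nhdsWithin_le_nhds) hFG
  simpa [F, G] using hlim

theorem prod_pow_range_sq (q : ℝ) (j : ℕ) :
    (∏ t ∈ Finset.range (j + 1), q ^ t) ^ 2 = q ^ ((j + 1) * j) := by
  rw [Finset.prod_pow_eq_pow_sum, ← pow_mul, Finset.sum_range_id_mul_two, Nat.add_sub_cancel]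

theorem reducedDenom_eq (z q : ℝ) (j s : ℕ) :
    reducedDenom z q j s
      = ∏ t ∈ (Finset.range (j + 1)).erase s, (1 - z * q ^ (s + t)) := by
  symm
  refine Finset.prod_nbij (fun t => s + t) ?_ ?_ ?_ fun _ _ => rfl
  · intro t ht
    simp only [Finset.mem_erase, Finset.mem_range, Finset.mem_Icc] at ht ⊢
    omega
  · intro t _ t' _ e
    exact Nat.add_left_cancel e
  · intro k hk
    simp only [Finset.coe_erase, Finset.coe_Icc, Set.mem_sdiff, Set.mem_Icc,
      Set.mem_singleton_iff] at hk
    refine ⟨k - s, ?_, by simp only; omega⟩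
    simp only [Finset.coe_erase, Finset.coe_range, Set.mem_sdiff, Set.mem_Iio,
      Set.mem_singleton_iff]
    omega

/-- Split `(z;q)_{s+j+1}` after `s` factors and after `j + 1` factors. -/
theorem reducedDenom_mul (z q : ℝ) {j s : ℕ} (hs : s ≤ j) :
    reducedDenom z q j s * ((1 - z * q ^ (2 * s)) * qPoch z q s)
      = (1 - z) * qPoch (z * q) q j * qPoch (z * q ^ (j + 1)) q s := by
  have hs' : s ∈ Finset.range (j + 1) := Finset.mem_range.2 (by omega)
  have e := qPoch_add z q s (j + 1)
  rw [add_comm, qPoch_add, qPoch_succ'] at e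
  rw [e, reducedDenom_eq, two_mul, ← mul_assoc,
    Finset.prod_erase_mul _ (fun t => 1 - z * q ^ (s + t)) hs', prod_one_sub_pow_add, mul_comm]

end ProductIdentities

/-! ### Closed form of the weights -/

section ClosedForm

variable {j : ℕ} {q a c : ℝ}

theorem derivative_R_last_eval (h : Admissible j q a c) (α : ℝ) {s : ℕ} (hs : s ≤ j) :
    (derivative (R q a c α j (2 * j + 2))).eval (lattice q a c (2 * s))
      = (∏ t ∈ (Finset.range (j + 1)).erase s, (lattice q a c (2 * s) - lattice q a c (2 * t)))
        * ∏ t ∈ Finset.range (j + 1), (lattice q a c (2 * s) - lattice q a c (2 * t + 1)) := by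
  have hs' : s ∈ Finset.range (j + 1) := Finset.mem_range.2 (by omega)
  have e := Lagrange.eval_nodal_derivative_eval_node_eq (v := fun t => lattice q a c (2 * t)) hs'
  rw [Lagrange.nodal, ← evenPoly] at e
  rw [R_last h, derivative_mul, eval_add, eval_mul, eval_mul, evenPoly_eval_even q a c hs,
    zero_mul, add_zero, e, evenPoly_swap_eval, Lagrange.eval_nodal]

theorem lattice_sub_even' (h : Admissible j q a c) (s t : ℕ) :
    lattice q a c (2 * s) - lattice q a c (2 * t)
      = -((1 - q ^ t / q ^ s) * (1 - a ^ 2 * q ^ (s + t)) / (2 * a * q ^ t)) := by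
  have ha := h.a_ne
  have h1 := pow_ne_zero s h.q_ne
  have h2 := pow_ne_zero t h.q_ne
  rw [lattice_sub_even h, pow_add]
  field_simp
  ring

theorem lattice_sub_odd' (h : Admissible j q a c) (s t : ℕ) :
    lattice q a c (2 * s) - lattice q a c (2 * t + 1)
      = -((1 - c / a * q ^ t / q ^ s) * (1 - a * c * q ^ (s + t)) / (2 * c * q ^ t)) := by
  have ha := h.a_ne
  have hc := h.c_ne
  have h1 := pow_ne_zero s h.q_ne
  have h2 := pow_ne_zero t h.q_ne
  rw [lattice_sub_odd h, pow_add]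
  field_simp
  ring

/-- The lattice differences factor into pieces in `t - s` and in `s + t`; each family is completed
to Pochhammer symbols. The minus sign comes from the `2 j + 1` negated differences. Stated without
division, so no denominator has to be known nonzero. -/
theorem derivative_R_last_mul (h : Admissible j q a c) (α : ℝ) {s : ℕ} (hs : s ≤ j) :
    (derivative (R q a c α j (2 * j + 2))).eval (lattice q a c (2 * s))
        * (2 ^ (2 * j + 1) * a ^ j * c ^ (j + 1) * q ^ ((2 * j + 1) * s + (j + 1) * j)
          * qPoch (q ^ (-(j : ℤ))) q s * qPoch (a * c) q s * qPoch (a * q ^ (-(j : ℤ)) / c) q s)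
      = -(qPoch q q j * qPoch (c / a) q (j + 1) * qPoch (a * c) q (j + 1)
        * reducedDenom (a ^ 2) q j s * qPoch q q s * qPoch (a * q / c) q s
        * qPoch (a * c * q ^ (j + 1)) q s) := by
  have ha := h.a_ne
  have hc := h.c_ne
  have hq := h.q_ne
  have hs' : s ∈ Finset.range (j + 1) := Finset.mem_range.2 (by omega)
  have card : ((Finset.range (j + 1)).erase s).card = j := by
    rw [Finset.card_erase_of_mem hs', Finset.card_range, Nat.add_sub_cancel]
  rw [derivative_R_last_eval h α hs]
  simp only [lattice_sub_even' h, lattice_sub_odd' h, Finset.prod_neg, Finset.prod_div_distrib,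
    Finset.prod_mul_distrib, Finset.prod_const, card, Finset.card_range, ← reducedDenom_eq]
  have hT : (∏ t ∈ (Finset.range (j + 1)).erase s, q ^ t) * q ^ s
      = ∏ t ∈ Finset.range (j + 1), q ^ t := Finset.prod_erase_mul _ _ hs'
  have hT2 := prod_pow_range_sq q j
  have hT0 : ∏ t ∈ Finset.range (j + 1), q ^ t ≠ 0 :=
    Finset.prod_ne_zero_iff.2 fun t _ => pow_ne_zero t hq
  have e1 := prod_erase_one_sub_mul_qPoch hq hs
  have e2 := prod_one_sub_mul_qPoch hq (div_ne_zero hc ha) j s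
  have e3 : (∏ t ∈ Finset.range (j + 1), (1 - a * c * q ^ (s + t))) * qPoch (a * c) q s
      = qPoch (a * c) q (j + 1) * qPoch (a * c * q ^ (j + 1)) q s := by
    rw [prod_one_sub_pow_add, mul_comm, ← qPoch_add, ← qPoch_add, add_comm]
  have f1 : (c / a)⁻¹ * (q ^ j)⁻¹ = a * (q ^ j)⁻¹ / c := by
    field_simp
  have f2 : (c / a)⁻¹ * q = a * q / c := by
    field_simp
  rw [f1, f2] at e2
  rw [zpow_neg_eq]
  have f3 : q ^ ((2 * j + 1) * s + (j + 1) * j) * q ^ s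
      = q ^ ((j + 1) * s) * q ^ ((j + 1) * s) * (∏ t ∈ Finset.range (j + 1), q ^ t) ^ 2 := by
    rw [hT2]
    ring
  have hqs := pow_ne_zero s hq
  have hT' : ∏ t ∈ (Finset.range (j + 1)).erase s, q ^ t
      = (∏ t ∈ Finset.range (j + 1), q ^ t) / q ^ s := by
    rw [← hT, mul_div_cancel_right₀ _ hqs]
  have sgn : (-1 : ℝ) ^ j * (-1) ^ (j + 1) = -1 := by
    rw [← pow_add, show j + (j + 1) = 2 * j + 1 by ring, pow_succ, pow_mul]
    norm_num
  have f4 : q ^ ((2 * j + 1) * s + (j + 1) * j)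
      = q ^ ((j + 1) * s) * q ^ ((j + 1) * s) * (∏ t ∈ Finset.range (j + 1), q ^ t) ^ 2 / q ^ s :=
    (eq_div_iff hqs).2 f3
  have f5 : (2 : ℝ) ^ (2 * j + 1) = 2 ^ j * 2 ^ (j + 1) := by ring
  rw [hT', f4, f5]
  have g1 := pow_ne_zero j ha
  have g2 := pow_ne_zero (j + 1) hc
  clear hT hT2 f3 f4 hT' f1 f2 f5 card
  generalize ∏ t ∈ Finset.range (j + 1), q ^ t = T at *
  generalize ∏ t ∈ (Finset.range (j + 1)).erase s, (1 - q ^ t / q ^ s) = E₁ at *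
  generalize ∏ t ∈ Finset.range (j + 1), (1 - c / a * q ^ t / q ^ s) = E₂ at *
  generalize ∏ t ∈ Finset.range (j + 1), (1 - a * c * q ^ (s + t)) = E₃ at *
  generalize q ^ ((j + 1) * s) = p at *
  generalize q ^ s = p' at *
  generalize a ^ j = a' at *
  generalize c ^ (j + 1) = c' at *
  have k1 : (2 : ℝ) ^ j ≠ 0 := by positivity
  have k2 : (2 : ℝ) ^ (j + 1) ≠ 0 := by positivity
  generalize (2 : ℝ) ^ j = b at *
  generalize (2 : ℝ) ^ (j + 1) = b' at *
  generalize (-1 : ℝ) ^ j = σ at *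
  generalize (-1 : ℝ) ^ (j + 1) = σ' at *
  generalize qPoch (q ^ j)⁻¹ q s = Q₁ at *
  generalize qPoch (a * (q ^ j)⁻¹ / c) q s = Q₂ at *
  generalize qPoch (a * c) q s = Q₃ at *
  generalize reducedDenom (a ^ 2) q j s = D
  trans σ * σ' * (E₁ * Q₁ * p) * (E₂ * Q₂ * p) * (E₃ * Q₃) * D
  · have hX : 1 / (b * a' * (T / p')) * (1 / (b' * c' * T)) * (b * b' * a' * c' * (T ^ 2 / p'))
        = 1 := by
      clear e1 e2 e3
      field_simp
    linear_combination σ * σ' * (E₁ * Q₁ * p) * (E₂ * Q₂ * p) * (E₃ * Q₃) * D * hX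
  · rw [sgn, e1, e2, e3]
    ring

theorem qPoch_ne_zero {z q : ℝ} {n : ℕ} (hz : ∀ k < n, z * q ^ k ≠ 1) : qPoch z q n ≠ 0 :=
  Finset.prod_ne_zero_iff.2 fun k hk => sub_ne_zero.2 (hz k (Finset.mem_range.1 hk)).symm

theorem weight_even_eq_reduced (h : Admissible j q a c) {α : ℝ} (h0 : 0 < α) (h1 : α < 1) {s : ℕ}
    (hs : s ≤ j) :
    reducedDenom (a ^ 2) q j s ≠ 0 ∧
      weight q a c α j (2 * s) = evenWeightReduced q a c α j s := by
  have ha := h.a_ne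
  have hc := h.c_ne
  have hq := h.q_pos
  have e := derivative_R_last_mul h 0 hs
  have hD : (derivative (R q a c 0 j (2 * j + 2))).eval (lattice q a c (2 * s)) ≠ 0 := by
    have := (weight_denom_pos h h0 h1 (i := 2 * s) (by omega)).ne'
    rw [R_last h, ← R_last h 0] at this
    exact right_ne_zero_of_mul this
  have hJ : q ^ j ≠ 0 := (pow_pos hq j).ne'
  have m1 : qPoch (q ^ (-(j : ℤ))) q s ≠ 0 := qPoch_ne_zero fun k hk e => by
    rw [zpow_neg_eq, inv_mul_eq_one₀ hJ] at e
    exact h.pow_ne_pow (by omega) e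
  have m2 : qPoch (a * c) q s ≠ 0 := qPoch_ne_zero fun k hk => h.mul_pow_ne_one (by omega)
  have m3 : qPoch (a * q ^ (-(j : ℤ)) / c) q s ≠ 0 := qPoch_ne_zero fun k hk e => by
    rw [zpow_neg_eq] at e
    field_simp at e
    exact h.mul_pow_ne_mul_pow k j (e.trans (mul_comm _ _))
  have hM : 2 ^ (2 * j + 1) * a ^ j * c ^ (j + 1) * q ^ ((2 * j + 1) * s + (j + 1) * j)
      * qPoch (q ^ (-(j : ℤ))) q s * qPoch (a * c) q s * qPoch (a * q ^ (-(j : ℤ)) / c) q s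
      ≠ 0 := by positivity
  -- Positivity of the weight gives a nonzero derivative, and through `e` every factor of the
  -- closed-form denominator is nonzero, `reducedDenom` included.
  have hZ := mul_ne_zero hD hM
  rw [e, neg_ne_zero] at hZ
  refine ⟨fun hr => hZ (by rw [hr]; ring), ?_⟩
  rw [weight_even h h0 h1 hs, evenWeightReduced, div_eq_div_iff hD hZ]
  linear_combination (2 * (1 - α) * KN q a c j) * e

theorem evenWeight_eq_reduced (h : Admissible j q a c) (α : ℝ) {s : ℕ} (hs : s ≤ j)
    (hz : a ^ 2 ≠ 1) (hz' : a ^ 2 * q ^ (2 * j) ≠ 1) :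
    evenWeight q a c α j s = evenWeightReduced q a c α j s := by
  have e := reducedDenom_mul (a ^ 2) q hs
  have hn : ∀ k ≤ 2 * j, a ^ 2 * q ^ k ≠ 1 := fun k hk => by
    rcases Nat.eq_zero_or_pos k with rfl | hk0
    · simpa using hz
    rcases hk.eq_or_lt with rfl | hk1
    · exact hz'
    · exact h.sq_mul_pow_ne_one hk0 hk1
  -- The factor cancelled between the two forms; the two extra hypotheses cover the exponents `0`
  -- and `2 j` missing from `sq_mul_pow_ne_one`.
  have n1 : (1 - a ^ 2 * q ^ (2 * s)) * qPoch (a ^ 2) q s ≠ 0 :=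
    mul_ne_zero (sub_ne_zero.2 (hn _ (by omega)).symm)
      (qPoch_ne_zero fun k hk => hn k (by omega))
  symm
  rw [evenWeight, evenWeightReduced, ← mul_div_mul_right _ _ n1]
  congr 1
  · ring
  · linear_combination (qPoch q q j * qPoch (c / a) q (j + 1) * qPoch (a * c) q (j + 1)
      * qPoch q q s * qPoch (a * q / c) q s * qPoch (a * c * q ^ (j + 1)) q s) * e

theorem oddWeight_eq_swap (h : Admissible j q a c) (α : ℝ) (s : ℕ) :
    oddWeight q a c α j s = evenWeight q c a (1 - α) j s := by
  rw [oddWeight, evenWeight, KN_swap h, mul_comm c a]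
  congr 1
  ring

theorem oddWeightReduced_eq_swap (h : Admissible j q a c) (α : ℝ) (s : ℕ) :
    oddWeightReduced q a c α j s = evenWeightReduced q c a (1 - α) j s := by
  rw [oddWeightReduced, evenWeightReduced, KN_swap h, mul_comm c a]
  congr 1
  ring

theorem weight_odd_eq_reduced (h : Admissible j q a c) {α : ℝ} (h0 : 0 < α) (h1 : α < 1) {s : ℕ}
    (hs : s ≤ j) :
    reducedDenom (c ^ 2) q j s ≠ 0 ∧
      weight q a c α j (2 * s + 1) = oddWeightReduced q a c α j s := by
  rw [weight_swap h, oddWeightReduced_eq_swap h]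
  exact weight_even_eq_reduced h.symm (by linarith) (by linarith) hs

end ClosedForm

end QParaRacah

theorem mainTheorem1 (j : ℕ) (q a c α : ℝ)
    (hq0 : 0 < q) (hq1 : q < 1) (hα0 : 0 < α) (hα1 : α < 1) (hca : c ≠ a)
    (hac_lower : q < a / c) (hac_upper : a / c < q⁻¹)
    (hac : a * c < 1 ∨ q ^ (1 - (2 * (j : ℤ) + 1)) < a * c) :
    -- the recurrence coefficients are positive
    (∀ n, 1 ≤ n → n ≤ 2 * j + 1 → 0 < uCoeff q a c α j n) ∧
    -- the `N + 1` lattice points are distinct and are the zeros of `R_{N+1}`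
    Set.InjOn (lattice q a c) (Set.Iic (2 * j + 1)) ∧
    R q a c α j (2 * j + 2)
      = ∏ i ∈ Finset.range (2 * j + 2), (X - C (lattice q a c i)) ∧
    -- the denominators in the formula that defines the weights do not vanish
    (∀ i ≤ 2 * j + 1,
      (R q a c α j (2 * j + 1)).eval (lattice q a c i)
        * (derivative (R q a c α j (2 * j + 2))).eval (lattice q a c i) ≠ 0) ∧
    -- the weights are positive
    (∀ i ≤ 2 * j + 1, 0 < weight q a c α j i) ∧
    -- the orthogonality relation
    (∀ n ≤ 2 * j + 1, ∀ m ≤ 2 * j + 1,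
      ∑ i ∈ Finset.range (2 * j + 2), weight q a c α j i
          * (R q a c α j n).eval (lattice q a c i) * (R q a c α j m).eval (lattice q a c i)
        = if n = m then uProd q a c α j n else 0) ∧
    -- the values of `R_N` on the lattice for `α = 1/2`
    (∀ i ≤ 2 * j + 1,
      (R q a c (1 / 2) j (2 * j + 1)).eval (lattice q a c i) = (-1) ^ i * KN q a c j) ∧
    -- the weights for `α` in terms of those for `α = 1/2`
    (∀ i ≤ 2 * j + 1,
      weight q a c α j i = (1 + (1 - 2 * α) * (-1) ^ i) * weight q a c (1 / 2) j i) ∧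
    -- the closed form of the weights
    (∀ s ≤ j, a ^ 2 ≠ 1 → a ^ 2 * q ^ (2 * j) ≠ 1 →
      weight q a c α j (2 * s) = evenWeight q a c α j s) ∧
    (∀ s ≤ j, c ^ 2 ≠ 1 → c ^ 2 * q ^ (2 * j) ≠ 1 →
      weight q a c α j (2 * s + 1) = oddWeight q a c α j s) ∧
    -- the closed form after cancellation of common factors, for all admissible parameters
    (∀ s ≤ j, reducedDenom (a ^ 2) q j s ≠ 0 ∧
      weight q a c α j (2 * s) = evenWeightReduced q a c α j s) ∧
    (∀ s ≤ j, reducedDenom (c ^ 2) q j s ≠ 0 ∧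
      weight q a c α j (2 * s + 1) = oddWeightReduced q a c α j s) ∧
    -- the normalization constant
    KN q a c j
      = Real.sign ((c - a) * (1 - a * c)) * Real.sqrt (uProd q a c (1 / 2) j (2 * j + 1)) ∧
    -- the total weights of the two sublattices
    ∑ s ∈ Finset.range (j + 1), weight q a c α j (2 * s) = 1 - α ∧
    ∑ s ∈ Finset.range (j + 1), weight q a c α j (2 * s + 1) = α := by
  have h : Admissible j q a c := ⟨hq0, hq1, hca, hac_lower, hac_upper, hac⟩
  refine ⟨fun n hn hn' => uCoeff_pos h hα0 hα1 hn hn', lattice_injOn h, R_last_eq_prod h α,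
    fun i hi => (weight_denom_pos h hα0 hα1 hi).ne', fun i hi => weight_pos h hα0 hα1 hi,
    fun n hn m hm => orthogonality h hα0 hα1 hn hm, fun i hi => eval_R_half h hi,
    fun i hi => weight_eq_mul_weight_half h hα0 hα1 hi, fun s hs h1 h2 => ?_,
    fun s hs h1 h2 => ?_, fun s hs => weight_even_eq_reduced h hα0 hα1 hs,
    fun s hs => weight_odd_eq_reduced h hα0 hα1 hs, KN_eq_sign_mul_sqrt h,
    (sum_weight h hα0 hα1).1, (sum_weight h hα0 hα1).2⟩
  · rw [(weight_even_eq_reduced h hα0 hα1 hs).2, evenWeight_eq_reduced h α hs h1 h2]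
  · rw [(weight_odd_eq_reduced h hα0 hα1 hs).2, oddWeightReduced_eq_swap h, oddWeight_eq_swap h,
      evenWeight_eq_reduced h.symm (1 - α) hs h1 h2]
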